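/- **Setting.** Let $\Omega\subset\mathbb R^n$ be a bounded, connected, nonempty open set with Lipschitz boundary, and let $g\in W^{1,\infty}(\Omega)\cap C(\overline\Omega)$. Let $H:\Omega\times\mathbb R^n\to\mathbb R$ be a Borel function such that 1. $H\ge 0$, $H(\cdot,0)=0$, and for every $x\in\Omega$ and $\lambda\in\mathbb R$ the sublevel set $\{p: H(x,p)\le\lambda\}$ is convex; 2. for every $\lambda$ there is $M\ge 0$ such that, for all $x\in\Omega$ and $p\in\mathbb R^n$, $H(x,p)\le\lambda$ implies $|p|\le M$; 3. $H(x,\cdot)$ is lower semicontinuous for every $x\in\Omega$; 4. for all $\lambda_1>\lambda_2\ge 0$ there is $\alpha>0$ such that $\{p:H(x,p)<\lambda_2\}+B(0,\alpha)\subset\{p:H(x,p)<\lambda_1\}$ for all $x\in\Omega$; 5. $H(\cdot,p)$ is continuous on $\Omega$ for every $p\in\mathbb R^n$; 6. for every $x\in\Omega$ and $\lambda\ge 0$ the level set $\{p:H(x,p)=\lambda\}$ has empty interior. For an open set $V\subset\Omega$ and $v\in W^{1,\infty}(V)$ put $F(v,V)=\operatorname{ess\,sup}_{x\in V}H(x,\nabla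 v(x))\in[0,\infty]$. Consider the supremal problem $$\mu:=\inf\{F(v,\Omega):\ v\in W^{1,\infty}(\Omega)\cap C(\overline\Omega),\ v=g\text{ on }\partial\Omega\}\tag{S}$$ and assume that $\mu>0$. An absolute minimizer of (S) is a function $u\in W^{1,\infty}(\Omega)\cap C(\overline\Omega)$ with $u=g$ on $\partial\Omega$ such that for every open $V\subset\subset\Omega$ and every $v\in W^{1,\infty}(V)\cap C(\overline V)$ with $v=u$ on $\partial V$ one has $F(u,V)\le F(v,V)$. For $\nu\in[0,\infty]$ let $\varphi^0_\nu(x,q)=\sup\{p\cdot q: H(x,p)\le\nu\}\in[0,\infty]$. For $x,y\in\Omega$ let $d_\nu(x,y)$ be the infimum of $\int_0^{\ell}\varphi^0_\nu(\gamma(s),\dot\gamma(s))\,ds$ over all $\ell\ge0$ and all Lipschitz curves $\gamma:[0,\ell]\to\Omega$ with $\gamma(0)=x$, $\gamma(\ell)=y$ and $|\dot\gamma|=1$ a.e.; if $x$ or $y$ lies on $\partial\Omega$, let $d_\nu(x,y)$ be the infimum of $\liminf_k d_\nu(x_k,y_k)$ over all sequences $x_k\to x$, $y_k\to y$ in $\Omega$.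 Put $d=d_\mu$ and $$S^+(x)=\inf_{y\in\partial\Omega}\bigl(g(y)+d(y,x)\bigr),\qquad S^-(x)=\sup_{y\in\partial\Omega}\bigl(g(y)-d(x,y)\bigr),\qquad \mathcal U=\{x\in\Omega: S^+(x)=S^-(x)\};$$ $\mathcal U$ is the uniqueness set. For $u\in W^{1,\infty}(\Omega)\cap C(\overline\Omega)$ and $x_0\in\Omega$ define the pointwise value $$H(x_0,\nabla u)(x_0)=\inf_{0<r<\operatorname{dist}(x_0,\partial\Omega)}\ \inf\{\nu\in[0,\infty]:\ u(x)-u(x_0)\le d_\nu(x_0,x)\text{ for all }x\in B(x_0,r)\},$$ and the attainment set $\mathcal A(u)=\{x\in\Omega: H(x,\nabla u)(x)=F(u,\Omega)=\mu\}$. **Theorem.** Let $u$ be an absolute minimizer of (S). If $x\in\Omega$ satisfies $H(x,\nabla u)(x)=F(u,\Omega)$, then $x\in\mathcal U$. Moreover $\mathcal A(u)=\mathcal U$. -/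

import Mathlib

open Set Filter Topology MeasureTheory
open scoped NNReal ENNReal ContDiff Pointwise

noncomputable section

namespace Supremal

/-- The Euclidean space `ℝⁿ`. -/
abbrev Rn (n : ℕ) : Type := EuclideanSpace ℝ (Fin n)

/-! ### Domains and Sobolev functions -/

/-- `Ω` has Lipschitz boundary: near every boundary point there are an axis `e` and a Lipschitz
function `f` of the component orthogonal to `e` such that `Ω` is locally the strict epigraph of
`f` in the direction `e`. -/
def HasLipschitzBoundary {n : ℕ} (Ω : Set (Rn n)) : Prop :=
  ∀ z ∈ frontier Ω, ∃ e : Rn n, ‖e‖ = 1 ∧ ∃ (f : Rn n → ℝ) (C : ℝ≥0), LipschitzWith C f ∧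
    ∃ r : ℝ, 0 < r ∧ ∀ x ∈ Metric.ball z r,
      (x ∈ Ω ↔ f (x - inner ℝ e x • e) < inner ℝ e x)

/-- `G ∈ L^∞(V; ℝⁿ)` is a weak (distributional) gradient of `u` on the open set `V`. -/
def IsWeakGradient {n : ℕ} (V : Set (Rn n)) (u : Rn n → ℝ) (G : Rn n → Rn n) : Prop :=
  MemLp G ∞ (volume.restrict V) ∧
  ∀ φ : Rn n → ℝ, ContDiff ℝ ∞ φ → HasCompactSupport φ → tsupport φ ⊆ V → ∀ w : Rn n,
    ∫ x in V, u x * fderiv ℝ φ x w = - ∫ x in V, φ x * inner ℝ (G x) w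

/-- `u ∈ W^{1,∞}(V)`. -/
def MemW1Inf {n : ℕ} (V : Set (Rn n)) (u : Rn n → ℝ) : Prop :=
  MemLp u ∞ (volume.restrict V) ∧ ∃ G : Rn n → Rn n, IsWeakGradient V u G

/-- `u ∈ W^{1,∞}(V) ∩ C(closure V)`. -/
def MemW1InfC {n : ℕ} (V : Set (Rn n)) (u : Rn n → ℝ) : Prop :=
  MemW1Inf V u ∧ ContinuousOn u (closure V)

open Classical in
/-- The weak gradient `∇u` on `V` (a representative; it is unique up to null subsets of `V`). -/
def weakGradient {n : ℕ} (V : Set (Rn n)) (u : Rn n → ℝ) : Rn n → Rn n :=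
  if h : ∃ G : Rn n → Rn n, IsWeakGradient V u G then h.choose else 0

/-! ### The supremal problem -/

/-- The standing assumptions on the supremand `H : Ω × ℝⁿ → ℝ`. -/
structure IsSupremand {n : ℕ} (Ω : Set (Rn n)) (H : Rn n → Rn n → ℝ) : Prop where
  borel : Measurable fun q : Ω × Rn n => H q.1 q.2
  nonneg : ∀ x ∈ Ω, ∀ p, 0 ≤ H x p
  map_zero : ∀ x ∈ Ω, H x 0 = 0
  quasiconvex : ∀ x ∈ Ω, ∀ l : ℝ, Convex ℝ {p | H x p ≤ l}
  coercive : ∀ l : ℝ, ∃ M : ℝ, 0 ≤ M ∧ ∀ x ∈ Ω, ∀ p, H x p ≤ l → ‖p‖ ≤ M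
  lowerSemicontinuous : ∀ x ∈ Ω, LowerSemicontinuous (H x)
  uniform_sublevels : ∀ l₁ l₂ : ℝ, 0 ≤ l₂ → l₂ < l₁ → ∃ α : ℝ, 0 < α ∧ ∀ x ∈ Ω,
    {p | H x p < l₂} + Metric.ball (0 : Rn n) α ⊆ {p | H x p < l₁}
  continuous_left : ∀ p, ContinuousOn (fun x => H x p) Ω
  interior_level : ∀ x ∈ Ω, ∀ l : ℝ, 0 ≤ l → interior {p | H x p = l} = ∅

/-- `F(v, V) = ess sup_{x ∈ V} H(x, ∇v(x)) ∈ [0, ∞]`. -/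
def supFunctional {n : ℕ} (H : Rn n → Rn n → ℝ) (V : Set (Rn n)) (v : Rn n → ℝ) : ℝ≥0∞ :=
  essSup (fun x => ENNReal.ofReal (H x (weakGradient V v x))) (volume.restrict V)

/-- The competitors `v ∈ g + W^{1,∞}(Ω) ∩ C₀(Ω)`. -/
def Admissible {n : ℕ} (Ω : Set (Rn n)) (g v : Rn n → ℝ) : Prop :=
  MemW1InfC Ω v ∧ ∀ y ∈ frontier Ω, v y = g y

/-- The value `μ` of the supremal problem with boundary datum `g`. -/
def minValue {n : ℕ} (H : Rn n → Rn n → ℝ) (Ω : Set (Rn n)) (g : Rn n → ℝ) : ℝ≥0∞ :=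
  ⨅ (v : Rn n → ℝ) (_ : Admissible Ω g v), supFunctional H Ω v

/-- `u` is an absolute minimizer of the supremal problem with boundary datum `g`.
(`Ω` is bounded in all uses, so `closure V ⊆ Ω` says that `V` is compactly contained in `Ω`.) -/
def IsAbsoluteMinimizer {n : ℕ} (H : Rn n → Rn n → ℝ) (Ω : Set (Rn n))
    (g u : Rn n → ℝ) : Prop :=
  Admissible Ω g u ∧
  ∀ V : Set (Rn n), IsOpen V → closure V ⊆ Ω →
    ∀ v : Rn n → ℝ, MemW1InfC V v → (∀ y ∈ frontier V, u y = v y) →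
      supFunctional H V u ≤ supFunctional H V v

/-! ### The Finsler distances of the sublevels -/

/-- `K_ν(x) = {p : H(x,p) ≤ ν}`, for a level `ν ∈ [0, ∞]`. -/
def sublevel {n : ℕ} (H : Rn n → Rn n → ℝ) (ν : ℝ≥0∞) (x : Rn n) : Set (Rn n) :=
  {p | ENNReal.ofReal (H x p) ≤ ν}

/-- The support function `φ⁰_ν(x,q) = sup {p · q : p ∈ K_ν(x)}`. As `0 ∈ K_ν(x)`, the supremum is
nonnegative, and replacing `p · q` by its positive part does not change it. -/
def supportFun {n : ℕ} (H : Rn n → Rn n → ℝ) (ν : ℝ≥0∞) (x q : Rn n) : ℝ≥0∞ :=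
  ⨆ p ∈ sublevel H ν x, ENNReal.ofReal (inner ℝ p q)

/-- `γ : [0,l] → Ω` is a Lipschitz curve from `x` to `y` parametrized by arc length. -/
def IsPath {n : ℕ} (Ω : Set (Rn n)) (x y : Rn n) (l : ℝ) (γ : ℝ → Rn n) : Prop :=
  0 ≤ l ∧ (∃ C : ℝ≥0, LipschitzOnWith C γ (Icc 0 l)) ∧ (∀ s ∈ Icc 0 l, γ s ∈ Ω) ∧
    γ 0 = x ∧ γ l = y ∧ ∀ᵐ s ∂(volume.restrict (Ioo 0 l)), ‖deriv γ s‖ = 1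

/-- The distance `d_ν(x,y)` for `x, y ∈ Ω`: infimum of the Finsler lengths of the curves in `Ω`. -/
def pathDist {n : ℕ} (H : Rn n → Rn n → ℝ) (Ω : Set (Rn n)) (ν : ℝ≥0∞) (x y : Rn n) : ℝ≥0∞ :=
  ⨅ (l : ℝ) (γ : ℝ → Rn n) (_ : IsPath Ω x y l γ),
    ∫⁻ s in Ioo 0 l, supportFun H ν (γ s) (deriv γ s)

open Classical in
/-- The distance `d_ν` on the closure of `Ω`: the distance above on `Ω × Ω`, and its relaxation
along sequences of points of `Ω` if one of the two points is on the boundary. -/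
def closureDist {n : ℕ} (H : Rn n → Rn n → ℝ) (Ω : Set (Rn n)) (ν : ℝ≥0∞) (x y : Rn n) : ℝ≥0∞ :=
  if x ∈ Ω ∧ y ∈ Ω then pathDist H Ω ν x y
  else ⨅ (a : ℕ → Rn n) (b : ℕ → Rn n) (_ : ∀ k, a k ∈ Ω) (_ : ∀ k, b k ∈ Ω)
    (_ : Tendsto a atTop (𝓝 x)) (_ : Tendsto b atTop (𝓝 y)),
      liminf (fun k => pathDist H Ω ν (a k) (b k)) atTop

/-- `S⁺(x) = inf {g(y) + d_ν(y,x) : y ∈ ∂Ω}`. -/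
def upperExt {n : ℕ} (H : Rn n → Rn n → ℝ) (Ω : Set (Rn n)) (g : Rn n → ℝ) (ν : ℝ≥0∞)
    (x : Rn n) : EReal :=
  ⨅ y ∈ frontier Ω, (g y : EReal) + (closureDist H Ω ν y x : EReal)

/-- `S⁻(x) = sup {g(y) - d_ν(x,y) : y ∈ ∂Ω}`. -/
def lowerExt {n : ℕ} (H : Rn n → Rn n → ℝ) (Ω : Set (Rn n)) (g : Rn n → ℝ) (ν : ℝ≥0∞)
    (x : Rn n) : EReal :=
  ⨆ y ∈ frontier Ω, (g y : EReal) - (closureDist H Ω ν x y : EReal)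

/-- The uniqueness set `𝒰 = {x ∈ Ω : S⁺(x) = S⁻(x)}`, at the level `ν = μ`. -/
def uniquenessSet {n : ℕ} (H : Rn n → Rn n → ℝ) (Ω : Set (Rn n)) (g : Rn n → ℝ) : Set (Rn n) :=
  {x | x ∈ Ω ∧ upperExt H Ω g (minValue H Ω g) x = lowerExt H Ω g (minValue H Ω g) x}

/-! ### The pointwise supremand and the attainment set -/

/-- `μ(x₀,r) = inf {ν ≥ 0 : u(x) - u(x₀) ≤ d_ν(x₀,x) for all x ∈ B(x₀,r)}`. -/
def localLevel {n : ℕ} (H : Rn n → Rn n → ℝ) (Ω : Set (Rn n)) (u : Rn n → ℝ) (x₀ : Rn n)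
    (r : ℝ) : ℝ≥0∞ :=
  sInf {ν | ∀ x ∈ Metric.ball x₀ r, ENNReal.ofReal (u x - u x₀) ≤ pathDist H Ω ν x₀ x}

/-- `H(x₀,∇u)(x₀) = inf_r μ(x₀,r)`, over `0 < r < dist(x₀,∂Ω)`. -/
def pointwiseH {n : ℕ} (H : Rn n → Rn n → ℝ) (Ω : Set (Rn n)) (u : Rn n → ℝ) (x₀ : Rn n) :
    ℝ≥0∞ :=
  ⨅ (r : ℝ) (_ : 0 < r) (_ : r < Metric.infDist x₀ (frontier Ω)), localLevel H Ω u x₀ r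

/-- The attainment set `𝒜(u) = {x ∈ Ω : H(x,∇u)(x) = ess sup H(·,∇u) = μ}`. -/
def attainmentSet {n : ℕ} (H : Rn n → Rn n → ℝ) (Ω : Set (Rn n)) (g u : Rn n → ℝ) :
    Set (Rn n) :=
  {x | x ∈ Ω ∧ pointwiseH H Ω u x = supFunctional H Ω u ∧
    supFunctional H Ω u = minValue H Ω g}

end Supremal

end

/-!
Throughout, `d_ν` is the Finsler distance of the sublevels `{H ≤ ν}` and `μ` is the minimal value.
The proof replaces the functional `F(u, V) ≤ ν` by the metric condition `SubFinsler`: along every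
curve of `V` the function `u` grows by at most the `ν`-length of the curve. The two are equivalent
for open `V`, finite `ν` and continuous `u ∈ W^{1,∞}(V)`. In one direction
(`IsWeakGradient.subFinsler`) the inequality is proved for mollifications of `u` and passes to the
limit because the sublevels are upper semicontinuous in `x`; in the other
(`SubFinsler.ae_mem_sublevel`) Rademacher's theorem and the separation of convex sets apply.
Absolute minimality then becomes a metric property, `IsMetricAbsoluteMinimizer`, which is invariant
under the reflection `u ↦ -u`, `H(x, p) ↦ H(x, -p)`, an operation that reverses the distances. It
gives `F(u, Ω) = μ` (`IsAbsoluteMinimizer.supFunctional_eq`), hence `S⁻ ≤ u ≤ S⁺`.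

A point `x₀` has `H(x₀, ∇u)(x₀) = μ` if and only if it is `SteepAt` level `μ`: for `ν < μ` the cone
`u(x₀) + d_ν(x₀, ·)` is exceeded by `u` arbitrarily close to `x₀`. It remains to identify these
points with the uniqueness set.

If `x₀` is steep, comparison with cones (`IsMetricAbsoluteMinimizer.le_pathDist_of_frontier`) shows
that for `ν < μ` the cone is exceeded on the boundary of every open set containing `x₀` and
compactly contained in `Ω`. The level `ν` can tend to `μ` on such a set because, the level sets of
`H` having empty interior, the sublevels are left continuous in the level uniformly on compact sets.
Exhausting `Ω` yields a boundary point `z` with `d_μ(x₀, z) ≤ g(z) - u(x₀)`, so that `S⁻(x₀) =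
u(x₀)`. The upward and downward slopes of `u` at `x₀` agree
(`IsMetricAbsoluteMinimizer.exists_reverse_le_pathDist`), so the reflected argument applies and
gives `S⁺(x₀) = u(x₀)`.

Conversely, if `S⁺(x₀) = S⁻(x₀)`, then `u(x₀) = S⁻(x₀)`, and along nearly minimal curves from `x₀`
to the boundary `u` grows at the full rate `μ`. Sublevels of different levels are separated by a
uniform distance, so `d_ν` is shorter than `d_μ` by a fixed proportion of the Euclidean length, and
`x₀` is steep.
-/

noncomputable section

namespace Supremal

variable {n : ℕ} {Ω U V W B B' : Set (Rn n)} {H : Rn n → Rn n → ℝ} {ν ν' μ : ℝ≥0∞}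
  {x y z x₀ : Rn n} {l : ℝ} {γ : ℝ → Rn n} {u v c g : Rn n → ℝ} {G : Rn n → Rn n}

/-! ### Sublevels of the supremand and their support functions -/

theorem mem_sublevel_iff_le_toReal (hν : ν ≠ ⊤) {x p : Rn n} :
    p ∈ sublevel H ν x ↔ H x p ≤ ν.toReal :=
  ENNReal.ofReal_le_iff_le_toReal hν

theorem sublevel_mono (h : ν ≤ ν') (x : Rn n) : sublevel H ν x ⊆ sublevel H ν' x :=
  fun _ hp => le_trans hp h

theorem supportFun_mono (h : ν ≤ ν') (x q : Rn n) : supportFun H ν x q ≤ supportFun H ν' x q :=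
  biSup_mono fun _ hp => sublevel_mono h x hp

theorem ofReal_inner_le_supportFun {x p : Rn n} (hp : p ∈ sublevel H ν x) (q : Rn n) :
    ENNReal.ofReal (inner ℝ p q) ≤ supportFun H ν x q :=
  le_iSup₂ (f := fun p (_ : p ∈ sublevel H ν x) => ENNReal.ofReal (inner ℝ p q)) p hp

theorem supportFun_le_of_norm_le {x : Rn n} {M : ℝ} (hM : ∀ p ∈ sublevel H ν x, ‖p‖ ≤ M)
    (q : Rn n) : supportFun H ν x q ≤ ENNReal.ofReal (M * ‖q‖) :=
  iSup₂_le fun p hp => ENNReal.ofReal_le_ofReal <|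
    (real_inner_le_norm p q).trans (mul_le_mul_of_nonneg_right (hM p hp) (norm_nonneg q))

theorem supportFun_le_add {x y : Rn n} {ε : ℝ}
    (h : ∀ p ∈ sublevel H ν x, ∃ p' ∈ sublevel H ν' y, ‖p - p'‖ ≤ ε) (q : Rn n) :
    supportFun H ν x q ≤ supportFun H ν' y q + ENNReal.ofReal (ε * ‖q‖) := by
  refine iSup₂_le fun p hp => ?_
  obtain ⟨p', hp', hpp⟩ := h p hp
  have h1 : inner ℝ p q ≤ inner ℝ p' q + ε * ‖q‖ := by
    have := (real_inner_le_norm (p - p') q).trans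
      (mul_le_mul_of_nonneg_right hpp (norm_nonneg q))
    rw [inner_sub_left] at this
    linarith
  calc ENNReal.ofReal (inner ℝ p q) ≤ ENNReal.ofReal (inner ℝ p' q + ε * ‖q‖) :=
        ENNReal.ofReal_le_ofReal h1
    _ ≤ _ := ENNReal.ofReal_add_le
    _ ≤ _ := by gcongr; exact ofReal_inner_le_supportFun hp' q

theorem supportFun_add_le {x : Rn n} {α : ℝ} (hα : 0 ≤ α) (h0 : (0 : Rn n) ∈ sublevel H ν x)
    (h : ∀ p ∈ sublevel H ν x, ∀ w : Rn n, ‖w‖ ≤ α → p + w ∈ sublevel H ν' x) (q : Rn n) :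
    supportFun H ν x q + ENNReal.ofReal (α * ‖q‖) ≤ supportFun H ν' x q := by
  rcases eq_or_ne q 0 with rfl | hq
  · simp [supportFun]
  have hq' : 0 < ‖q‖ := norm_pos_iff.2 hq
  set w : Rn n := (α / ‖q‖) • q with hw
  have hwn : ‖w‖ ≤ α := by
    rw [hw, norm_smul, Real.norm_of_nonneg (by positivity)]
    field_simp; rfl
  have hwq : inner ℝ w q = α * ‖q‖ := by
    rw [hw, real_inner_smul_left, real_inner_self_eq_norm_sq]
    field_simp
  have hne : (sublevel H ν x).Nonempty := ⟨0, h0⟩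
  rw [supportFun, ENNReal.biSup_add hne]
  refine iSup₂_le fun p hp => ?_
  rcases le_total 0 (inner ℝ p q) with hpq | hpq
  · rw [← ENNReal.ofReal_add hpq (by positivity), ← hwq, ← inner_add_left]
    exact ofReal_inner_le_supportFun (h p hp w hwn) q
  · rw [ENNReal.ofReal_of_nonpos hpq, zero_add, ← hwq]
    have := ofReal_inner_le_supportFun (h 0 h0 w hwn) q
    rwa [zero_add] at this

namespace IsSupremand

theorem zero_mem_sublevel (hH : IsSupremand Ω H) {x : Rn n} (hx : x ∈ Ω) :
    (0 : Rn n) ∈ sublevel H ν x := by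
  simp [sublevel, hH.map_zero x hx]

theorem exists_norm_le (hH : IsSupremand Ω H) (hν : ν ≠ ⊤) :
    ∃ M : ℝ, 0 ≤ M ∧ ∀ x ∈ Ω, ∀ p ∈ sublevel H ν x, ‖p‖ ≤ M := by
  obtain ⟨M, hM, h⟩ := hH.coercive ν.toReal
  exact ⟨M, hM, fun x hx p hp => h x hx p ((mem_sublevel_iff_le_toReal hν).1 hp)⟩

/-- Different sublevels are separated by a distance which does not depend on the point. -/
theorem exists_add_mem_sublevel (hH : IsSupremand Ω H) (h : ν < ν') :
    ∃ α : ℝ, 0 < α ∧ ∀ x ∈ Ω, ∀ p ∈ sublevel H ν x, ∀ w : Rn n, ‖w‖ ≤ α →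
      p + w ∈ sublevel H ν' x := by
  obtain ⟨c, hc, hcν⟩ := exists_between h
  have hν : ν ≠ ⊤ := h.ne_top
  have hct : c ≠ ⊤ := hcν.ne_top
  obtain ⟨b, hb, hbc⟩ := exists_between hc
  have hbt : b ≠ ⊤ := hbc.ne_top
  obtain ⟨α, hα, hsub⟩ := hH.uniform_sublevels c.toReal b.toReal ENNReal.toReal_nonneg
    ((ENNReal.toReal_lt_toReal hbt hct).2 hbc)
  refine ⟨α / 2, by positivity, fun x hx p hp w hw => ?_⟩
  have hp' : H x p < b.toReal := ((mem_sublevel_iff_le_toReal hν).1 hp).trans_lt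
    ((ENNReal.toReal_lt_toReal hν hbt).2 hb)
  have hmem : p + w ∈ {p | H x p < c.toReal} := hsub x hx
    (Set.add_mem_add hp' (by rw [mem_ball_zero_iff]; linarith))
  exact sublevel_mono hcν.le x ((mem_sublevel_iff_le_toReal hct).2 (le_of_lt hmem))

theorem exists_supportFun_add_le (hH : IsSupremand Ω H) (h : ν < ν') :
    ∃ α : ℝ, 0 < α ∧ ∀ x ∈ Ω, ∀ q, supportFun H ν x q + ENNReal.ofReal (α * ‖q‖) ≤
      supportFun H ν' x q := by
  obtain ⟨α, hα, h'⟩ := hH.exists_add_mem_sublevel h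
  exact ⟨α, hα, fun x hx => supportFun_add_le hα.le (hH.zero_mem_sublevel hx) (h' x hx)⟩

theorem exists_le_supportFun (hH : IsSupremand Ω H) (h : 0 < ν) :
    ∃ α : ℝ, 0 < α ∧ ∀ x ∈ Ω, ∀ q, ENNReal.ofReal (α * ‖q‖) ≤ supportFun H ν x q := by
  obtain ⟨α, hα, h'⟩ := hH.exists_supportFun_add_le h
  exact ⟨α, hα, fun x hx q => le_add_self.trans (h' x hx q)⟩

theorem supportFun_top (hH : IsSupremand Ω H) {x q : Rn n} (hx : x ∈ Ω) (hq : q ≠ 0) :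
    supportFun H ⊤ x q = ⊤ := by
  have hq' : 0 < ‖q‖ := norm_pos_iff.2 hq
  have key := supportFun_add_le (H := H) (ν := ⊤) (ν' := ⊤) (α := 1 / ‖q‖) (by positivity)
    (hH.zero_mem_sublevel hx) (fun _ _ _ _ => (le_top : ENNReal.ofReal _ ≤ ⊤)) q
  rw [one_div_mul_cancel hq'.ne', ENNReal.ofReal_one] at key
  by_contra hne
  exact absurd key (not_le.2 (ENNReal.lt_add_right hne one_ne_zero))

theorem convex_sublevel (hH : IsSupremand Ω H) (hν : ν ≠ ⊤) {x : Rn n} (hx : x ∈ Ω) :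
    Convex ℝ (sublevel H ν x) := by
  have : sublevel H ν x = {p | H x p ≤ ν.toReal} :=
    Set.ext fun p => mem_sublevel_iff_le_toReal hν
  exact this ▸ hH.quasiconvex x hx _

theorem isClosed_sublevel (hH : IsSupremand Ω H) (hν : ν ≠ ⊤) {x : Rn n} (hx : x ∈ Ω) :
    IsClosed (sublevel H ν x) := by
  have : sublevel H ν x = H x ⁻¹' Iic ν.toReal :=
    Set.ext fun p => mem_sublevel_iff_le_toReal hν
  exact this ▸ (hH.lowerSemicontinuous x hx).isClosed_preimage _

theorem mem_sublevel_of_inner_le (hH : IsSupremand Ω H) (hν : ν ≠ ⊤) {x p : Rn n} (hx : x ∈ Ω)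
    (h : ∀ q, ENNReal.ofReal (inner ℝ p q) ≤ supportFun H ν x q) : p ∈ sublevel H ν x := by
  by_contra hp
  obtain ⟨f, b, hfb, hbp⟩ := geometric_hahn_banach_closed_point (hH.convex_sublevel hν hx)
    (hH.isClosed_sublevel hν hx) hp
  have hf : ∀ a, f a = inner ℝ a ((InnerProductSpace.toDual ℝ (Rn n)).symm f) := fun a => by
    rw [real_inner_comm, InnerProductSpace.toDual_symm_apply]
  have hb : 0 < b := by simpa using hfb 0 (hH.zero_mem_sublevel hx)
  have h1 : supportFun H ν x ((InnerProductSpace.toDual ℝ (Rn n)).symm f) ≤ ENNReal.ofReal b :=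
    iSup₂_le fun a ha => ENNReal.ofReal_le_ofReal ((hf a) ▸ (hfb a ha).le)
  have h2 := (h _).trans h1
  rw [← hf, ENNReal.ofReal_le_ofReal_iff hb.le] at h2
  exact absurd hbp (not_lt.2 h2)

/-- The sublevel multifunction has closed graph. Continuity of `H(·,p)` alone would not give this;
the uniform separation of the sublevels lets one replace the varying gradients by their limit. -/
theorem mem_sublevel_of_tendsto (hH : IsSupremand Ω H) (hν : ν ≠ ⊤) {x p : Rn n} (hx : x ∈ Ω)
    {y q : ℕ → Rn n} (hy : ∀ k, y k ∈ Ω) (hyx : Tendsto y atTop (𝓝 x))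
    (hq : ∀ k, q k ∈ sublevel H ν (y k)) (hqp : Tendsto q atTop (𝓝 p)) : p ∈ sublevel H ν x := by
  rw [mem_sublevel_iff_le_toReal hν]
  refine le_of_forall_gt_imp_ge_of_dense fun b hb => ?_
  have hνb : ν < ENNReal.ofReal b := (ENNReal.lt_ofReal_iff_toReal_lt hν).2 hb
  obtain ⟨α, hα, h⟩ := hH.exists_add_mem_sublevel hνb
  have hcont : Tendsto (fun k => H (y k) p) atTop (𝓝 (H x p)) :=
    ((hH.continuous_left p x hx).tendsto).comp
      (tendsto_nhdsWithin_iff.2 ⟨hyx, Eventually.of_forall hy⟩)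
  refine le_of_tendsto hcont ?_
  filter_upwards [hqp.eventually (Metric.ball_mem_nhds p hα)] with k hk
  have := h (y k) (hy k) (q k) (hq k) (p - q k) (by rw [← dist_eq_norm, dist_comm]; exact hk.le)
  rw [add_sub_cancel, mem_sublevel_iff_le_toReal ENNReal.ofReal_ne_top,
    ENNReal.toReal_ofReal (ENNReal.toReal_nonneg.trans hb.le)] at this
  exact this

/-- Upper semicontinuity of the sublevels. -/
theorem exists_sublevel_near (hH : IsSupremand Ω H) (hν : ν ≠ ⊤) {x : Rn n} (hx : x ∈ Ω)
    {ε : ℝ} (hε : 0 < ε) : ∃ δ : ℝ, 0 < δ ∧ ∀ y ∈ Ω, dist y x < δ → ∀ p ∈ sublevel H ν y,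
      ∃ p' ∈ sublevel H ν x, ‖p - p'‖ ≤ ε := by
  by_contra! hcon
  choose y hyΩ hyx p hp hfar using fun k : ℕ => hcon (1 / ((k : ℝ) + 1)) (by positivity)
  obtain ⟨M, -, hM⟩ := hH.exists_norm_le hν
  obtain ⟨q, -, φ, hφ, hq⟩ := tendsto_subseq_of_bounded (x := p)
    (Metric.isBounded_closedBall (x := (0 : Rn n)) (r := M))
    (fun k => by simpa using hM _ (hyΩ k) _ (hp k))
  have hyt : Tendsto y atTop (𝓝 x) := tendsto_iff_dist_tendsto_zero.2 <|
    squeeze_zero (fun _ => dist_nonneg) (fun k => (hyx k).le)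
      tendsto_one_div_add_atTop_nhds_zero_nat
  have hmem := hH.mem_sublevel_of_tendsto hν hx (fun k => hyΩ (φ k))
    (hyt.comp hφ.tendsto_atTop) (fun k => hp (φ k)) hq
  obtain ⟨k, hk⟩ := (hq.eventually (Metric.ball_mem_nhds q hε)).exists
  have := hfar (φ k) q hmem
  rw [← dist_eq_norm] at this
  exact absurd hk (not_lt.2 this.le)

/-- The only use of the empty interior of the level sets: strict sublevels are dense in
sublevels. -/
theorem exists_lt_near (hH : IsSupremand Ω H) (hν : ν ≠ ⊤) (hν0 : 0 < ν) {x p : Rn n}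
    (hx : x ∈ Ω) (hp : p ∈ sublevel H ν x) {ε : ℝ} (hε : 0 < ε) :
    ∃ p', ‖p - p'‖ < ε ∧ H x p' < ν.toReal := by
  obtain ⟨α, hα, h⟩ := hH.exists_add_mem_sublevel hν0
  have hball : ∀ w : Rn n, ‖w‖ ≤ α → w ∈ sublevel H ν x := fun w hw => by
    simpa using h x hx 0 (hH.zero_mem_sublevel hx) w hw
  -- `(1 - t) p` is an interior point of the sublevel, at distance less than `ε / 2` from `p`
  obtain ⟨t, ht0, ht1, htp⟩ : ∃ t : ℝ, 0 < t ∧ t ≤ 1 ∧ t * ‖p‖ < ε / 2 := by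
    refine ⟨min 1 (ε / 4 / (‖p‖ + 1)), by positivity, min_le_left _ _, ?_⟩
    calc min 1 (ε / 4 / (‖p‖ + 1)) * ‖p‖ ≤ ε / 4 / (‖p‖ + 1) * (‖p‖ + 1) := by
          gcongr
          · exact min_le_right _ _
          · linarith
      _ = ε / 4 := by field_simp
      _ < ε / 2 := by linarith
  set r : ℝ := min (t * α) (ε / 2) with hr
  have hr0 : 0 < r := by positivity
  have hsub : Metric.ball ((1 - t) • p) r ⊆ sublevel H ν x := by
    intro z hz
    rw [mem_ball_iff_norm] at hz
    have hz' : t⁻¹ • (z - (1 - t) • p) ∈ sublevel H ν x := by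
      apply hball
      rw [norm_smul, norm_inv, Real.norm_of_nonneg ht0.le, inv_mul_le_iff₀ ht0]
      exact hz.le.trans (min_le_left _ _)
    have := (hH.convex_sublevel hν hx) hp hz' (sub_nonneg.2 ht1) ht0.le (by ring)
    rwa [smul_inv_smul₀ ht0.ne', add_sub_cancel] at this
  have hne : ¬ Metric.ball ((1 - t) • p) r ⊆ {q | H x q = ν.toReal} := by
    intro hs
    have := interior_maximal hs Metric.isOpen_ball
    rw [hH.interior_level x hx _ ENNReal.toReal_nonneg] at this
    exact this (Metric.mem_ball_self hr0)
  obtain ⟨q, hq, hqne⟩ := Set.not_subset.1 hne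
  refine ⟨q, ?_, lt_of_le_of_ne ((mem_sublevel_iff_le_toReal hν).1 (hsub hq)) hqne⟩
  have h1 : ‖p - (1 - t) • p‖ < ε / 2 := by
    have : p - (1 - t) • p = t • p := by module
    rwa [this, norm_smul, Real.norm_of_nonneg ht0.le]
  have h2 : ‖(1 - t) • p - q‖ < ε / 2 := by
    rw [← dist_eq_norm, dist_comm]
    exact (Metric.mem_ball.1 hq).trans_le (min_le_right _ _)
  calc ‖p - q‖ = ‖(p - (1 - t) • p) + ((1 - t) • p - q)‖ := by congr 1; abel
    _ ≤ _ := norm_add_le _ _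
    _ < ε := by linarith

/-- The sublevels are left continuous in the level, uniformly on compact subsets of `Ω`. Near the
boundary of `Ω` this uniformity may fail. -/
theorem exists_lt_sublevel_near (hH : IsSupremand Ω H) (hν : ν ≠ ⊤) (hν0 : 0 < ν)
    {K : Set (Rn n)} (hK : IsCompact K) (hKΩ : K ⊆ Ω) {ε : ℝ} (hε : 0 < ε) :
    ∃ ν' < ν, ∀ x ∈ K, ∀ p ∈ sublevel H ν x, ∃ p' ∈ sublevel H ν' x, ‖p - p'‖ ≤ ε := by
  by_contra! hcon
  obtain ⟨a, -, ha, haν⟩ := exists_seq_strictMono_tendsto' hν0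
  choose x hxK p hp hfar using fun k : ℕ => hcon (a k) (ha k).2
  obtain ⟨x₀, hx₀, φ, hφ, hxφ⟩ := hK.tendsto_subseq hxK
  obtain ⟨M, -, hM⟩ := hH.exists_norm_le hν
  obtain ⟨q, -, ψ, hψ, hq⟩ := tendsto_subseq_of_bounded (x := p ∘ φ)
    (Metric.isBounded_closedBall (x := (0 : Rn n)) (r := M))
    (fun k => by simpa using hM _ (hKΩ (hxK _)) _ (hp _))
  have hxψ := hxφ.comp hψ.tendsto_atTop
  have hqm := hH.mem_sublevel_of_tendsto hν (hKΩ hx₀) (fun k => hKΩ (hxK (φ (ψ k)))) hxψ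
    (fun k => hp (φ (ψ k))) hq
  obtain ⟨q', hqq', hq'⟩ := hH.exists_lt_near hν hν0 (hKΩ hx₀) hqm (half_pos hε)
  obtain ⟨c, hc, hcν⟩ : ∃ c : ℝ≥0∞, H x₀ q' < c.toReal ∧ c < ν := by
    obtain ⟨b, hb1, hb2⟩ := exists_between hq'
    have hb0 : 0 ≤ b := (hH.nonneg x₀ (hKΩ hx₀) q').trans hb1.le
    exact ⟨ENNReal.ofReal b, by rwa [ENNReal.toReal_ofReal hb0],
      (ENNReal.ofReal_lt_iff_lt_toReal hb0 hν).2 hb2⟩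
  have hcont : Tendsto (fun k => H (x (φ (ψ k))) q') atTop (𝓝 (H x₀ q')) :=
    ((hH.continuous_left q' x₀ (hKΩ hx₀)).tendsto).comp
      (tendsto_nhdsWithin_iff.2 ⟨hxψ, Eventually.of_forall fun k => hKΩ (hxK _)⟩)
  have haψ : Tendsto (fun k => a (φ (ψ k))) atTop (𝓝 ν) :=
    haν.comp (hφ.comp hψ).tendsto_atTop
  obtain ⟨k, hk1, hk2, hk3⟩ := ((hcont.eventually (gt_mem_nhds hc)).and
    ((haψ.eventually (lt_mem_nhds hcν)).and
      (hq.eventually (Metric.ball_mem_nhds q (half_pos hε))))).exists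
  have hmem : q' ∈ sublevel H (a (φ (ψ k))) (x (φ (ψ k))) :=
    sublevel_mono hk2.le _ ((mem_sublevel_iff_le_toReal hcν.ne_top).2 hk1.le)
  have h1 := hfar _ q' hmem
  have h2 : ‖p (φ (ψ k)) - q‖ < ε / 2 := by rw [← dist_eq_norm]; exact hk3
  have h3 : ‖p (φ (ψ k)) - q'‖ ≤ ‖p (φ (ψ k)) - q‖ + ‖q - q'‖ :=
    norm_sub_le_norm_sub_add_norm_sub _ _ _
  linarith

/-- On compact sets `H` is bounded for bounded gradients: it suffices to bound it at the vertices
of a large cross-polytope. -/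
theorem exists_closedBall_subset_sublevel (hH : IsSupremand Ω H) {K : Set (Rn n)}
    (hK : IsCompact K) (hKΩ : K ⊆ Ω) (C : ℝ) :
    ∃ ν : ℝ≥0∞, ν ≠ ⊤ ∧ ∀ x ∈ K, ∀ p : Rn n, ‖p‖ ≤ C → p ∈ sublevel H ν x := by
  rcases Nat.eq_zero_or_pos n with rfl | hn
  · exact ⟨0, ENNReal.zero_ne_top, fun x hx p _ =>
      Subsingleton.elim (0 : Rn 0) p ▸ hH.zero_mem_sublevel (hKΩ hx)⟩
  set R : ℝ := n * max C 1 with hR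
  have hn' : (0 : ℝ) < n := by exact_mod_cast hn
  have hR0 : 0 < R := by positivity
  let v : Fin n × Bool → Rn n := fun i =>
    (if i.2 then R else -R) • EuclideanSpace.single i.1 (1 : ℝ)
  have hbd : ∀ i, ∃ b, ∀ x ∈ K, H x (v i) ≤ b := fun i => by
    obtain ⟨b, hb⟩ := (hK.image_of_continuousOn ((hH.continuous_left (v i)).mono hKΩ)).bddAbove
    exact ⟨b, fun x hx => hb (mem_image_of_mem _ hx)⟩
  choose b hb using hbd
  obtain ⟨c, hc⟩ := (Set.finite_range b).bddAbove
  refine ⟨ENNReal.ofReal c, ENNReal.ofReal_ne_top, fun x hx p hp => ?_⟩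
  have hconv := hH.convex_sublevel (ν := ENNReal.ofReal c) ENNReal.ofReal_ne_top (hKΩ hx)
  have hv : ∀ i, v i ∈ sublevel H (ENNReal.ofReal c) x := fun i =>
    ENNReal.ofReal_le_ofReal ((hb i x hx).trans (hc (mem_range_self i)))
  have hcoord : ∀ i : Fin n, ((n : ℝ) * p i) • EuclideanSpace.single i (1 : ℝ) ∈
      sublevel H (ENNReal.ofReal c) x := fun i => by
    have hpi : |p i| ≤ max C 1 := ((PiLp.norm_apply_le p i).trans hp).trans (le_max_left _ _)
    have habs : |(n : ℝ) * p i| ≤ R := by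
      rw [abs_mul, abs_of_pos hn', hR]; gcongr
    have ht : |(n : ℝ) * p i| / R ∈ Icc (0 : ℝ) 1 :=
      ⟨by positivity, (div_le_one hR0).2 habs⟩
    rcases le_total 0 ((n : ℝ) * p i) with h | h
    · have := hconv.smul_mem_of_zero_mem (hH.zero_mem_sublevel (hKΩ hx)) (hv (i, true)) ht
      simp only [v, if_true, smul_smul] at this
      rwa [div_mul_cancel₀ _ hR0.ne', abs_of_nonneg h] at this
    · have := hconv.smul_mem_of_zero_mem (hH.zero_mem_sublevel (hKΩ hx)) (hv (i, false)) ht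
      simp only [v, smul_smul] at this
      rw [abs_of_nonpos h] at this
      convert this using 2
      simp
      field_simp
  have hsum := hconv.sum_mem (t := Finset.univ) (w := fun _ : Fin n => (n : ℝ)⁻¹)
    (z := fun i => ((n : ℝ) * p i) • EuclideanSpace.single i (1 : ℝ))
    (fun _ _ => by positivity) (by simp [hn'.ne']) (fun i _ => hcoord i)
  convert hsum using 1
  ext j
  simp [hn'.ne', Finset.sum_apply, Pi.single_apply]

end IsSupremand

/-- The supremand with the gradient variable reflected. It governs `-u` when `H` governs `u`, and
reverses the Finsler distances. -/
def reflect (H : Rn n → Rn n → ℝ) : Rn n → Rn n → ℝ := fun x p => H x (-p)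

theorem supportFun_reflect (x q : Rn n) : supportFun (reflect H) ν x q = supportFun H ν x (-q) := by
  refine le_antisymm (iSup₂_le fun p hp => ?_) (iSup₂_le fun p hp => ?_)
  · have := ofReal_inner_le_supportFun (H := H) (ν := ν) (x := x) (p := -p) hp (-q)
    rwa [inner_neg_neg] at this
  · have := ofReal_inner_le_supportFun (H := reflect H) (ν := ν) (x := x) (p := -p)
      (by simpa [sublevel, reflect] using hp) q
    rwa [inner_neg_left, ← inner_neg_right] at this

theorem IsSupremand.reflect (hH : IsSupremand Ω H) : IsSupremand Ω (reflect H) where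
  borel := hH.borel.comp (measurable_fst.prodMk measurable_snd.neg)
  nonneg x hx p := hH.nonneg x hx (-p)
  map_zero x hx := by simpa [Supremal.reflect] using hH.map_zero x hx
  quasiconvex x hx l := (hH.quasiconvex x hx l).neg
  coercive l := by
    obtain ⟨M, hM, h⟩ := hH.coercive l
    exact ⟨M, hM, fun x hx p hp => norm_neg p ▸ h x hx (-p) hp⟩
  lowerSemicontinuous x hx := LowerSemicontinuous.comp (hH.lowerSemicontinuous x hx) continuous_neg
  uniform_sublevels l₁ l₂ h₀ h := by
    obtain ⟨α, hα, hs⟩ := hH.uniform_sublevels l₁ l₂ h₀ h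
    refine ⟨α, hα, fun x hx => ?_⟩
    rintro _ ⟨p, hp, w, hw, rfl⟩
    have : -p + -w ∈ {p | H x p < l₁} := hs x hx
      (Set.add_mem_add hp (by simpa using hw))
    simpa [Supremal.reflect, add_comm] using this
  continuous_left p := hH.continuous_left (-p)
  interior_level x hx l hl := by
    have : {p | Supremal.reflect H x p = l} = Homeomorph.neg (Rn n) ⁻¹' {p | H x p = l} := rfl
    rw [this, ← Homeomorph.preimage_interior, hH.interior_level x hx l hl, preimage_empty]

theorem reflect_reflect : reflect (reflect H) = H := by
  funext x p; simp [reflect]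

/-! ### Curves and the Finsler distances -/

/-- The Finsler length of `γ` between the parameters `a` and `b`. -/
def finslerLength (H : Rn n → Rn n → ℝ) (ν : ℝ≥0∞) (γ : ℝ → Rn n) (a b : ℝ) : ℝ≥0∞ :=
  ∫⁻ s in Ioo a b, supportFun H ν (γ s) (deriv γ s)

theorem IsPath.pathDist_le (h : IsPath U x y l γ) : pathDist H U ν x y ≤ finslerLength H ν γ 0 l :=
  iInf_le_of_le l <| iInf_le_of_le γ <| iInf_le _ h

theorem le_pathDist {c : ℝ≥0∞} (h : ∀ l γ, IsPath U x y l γ → c ≤ finslerLength H ν γ 0 l) :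
    c ≤ pathDist H U ν x y :=
  le_iInf fun l => le_iInf fun γ => le_iInf fun hγ => h l γ hγ

theorem exists_isPath_of_pathDist_lt {c : ℝ≥0∞} (h : pathDist H U ν x y < c) :
    ∃ l γ, IsPath U x y l γ ∧ finslerLength H ν γ 0 l < c := by
  simpa only [pathDist, iInf_lt_iff, exists_prop, finslerLength] using h

theorem pathDist_anti (h : V ⊆ U) : pathDist H U ν x y ≤ pathDist H V ν x y :=
  le_pathDist fun _ _ hγ => IsPath.pathDist_le
    ⟨hγ.1, hγ.2.1, fun s hs => h (hγ.2.2.1 s hs), hγ.2.2.2⟩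

theorem finslerLength_add_adjacent {a b c : ℝ} (hab : a ≤ b) (hbc : b ≤ c) :
    finslerLength H ν γ a b + finslerLength H ν γ b c = finslerLength H ν γ a c := by
  simp only [finslerLength, setLIntegral_congr Ioo_ae_eq_Ioc]
  rw [← Ioc_union_Ioc_eq_Ioc hab hbc, lintegral_union measurableSet_Ioc]
  exact Set.disjoint_left.2 fun s h1 h2 => absurd h1.2 (not_le.2 h2.1)

theorem finslerLength_mono {a b c d : ℝ} (hca : c ≤ a) (hbd : b ≤ d) :
    finslerLength H ν γ a b ≤ finslerLength H ν γ c d :=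
  lintegral_mono_set (Ioo_subset_Ioo hca hbd)

theorem finslerLength_shift (a b c : ℝ) :
    finslerLength H ν (fun s => γ (s + c)) a b = finslerLength H ν γ (a + c) (b + c) := by
  have h := (measurePreserving_add_right (volume : Measure ℝ) c).setLIntegral_comp_preimage_emb
    (measurableEmbedding_addRight c) (fun s => supportFun H ν (γ s) (deriv γ s))
    (Ioo (a + c) (b + c))
  rw [finslerLength, finslerLength, ← h]
  simp [deriv_comp_add_const]

theorem finslerLength_congr {γ' : ℝ → Rn n} {a b : ℝ} (h : EqOn γ γ' (Ioo a b)) :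
    finslerLength H ν γ a b = finslerLength H ν γ' a b := by
  refine setLIntegral_congr_fun measurableSet_Ioo fun s hs => ?_
  have he : γ =ᶠ[𝓝 s] γ' := h.eventuallyEq_of_mem (isOpen_Ioo.mem_nhds hs)
  simp only [h hs, he.deriv_eq]

theorem ofReal_mul_eq_lintegral (hl : 0 ≤ l) (α : ℝ) :
    ENNReal.ofReal (α * l) = ∫⁻ _ in Ioo 0 l, ENNReal.ofReal α := by
  rw [setLIntegral_const, Real.volume_Ioo, sub_zero, ENNReal.ofReal_mul' hl]

namespace IsPath

theorem left_mem (h : IsPath U x y l γ) : x ∈ U :=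
  h.2.2.2.1 ▸ h.2.2.1 0 (left_mem_Icc.2 h.1)

theorem right_mem (h : IsPath U x y l γ) : y ∈ U :=
  h.2.2.2.2.1 ▸ h.2.2.1 l (right_mem_Icc.2 h.1)

theorem continuousOn (h : IsPath U x y l γ) : ContinuousOn γ (Icc 0 l) :=
  let ⟨_, hC⟩ := h.2.1; hC.continuousOn

/-- Arc-length parametrized curves are 1-Lipschitz. -/
theorem norm_sub_le (h : IsPath U x y l γ) {s t : ℝ} (hs : 0 ≤ s) (hst : s ≤ t) (ht : t ≤ l) :
    ‖γ t - γ s‖ ≤ t - s := by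
  obtain ⟨-, ⟨C, hC⟩, -, -, -, hd⟩ := h
  set w := γ t - γ s with hw
  let f : ℝ → ℝ := fun r => innerSL ℝ w (γ r)
  have hsub : uIcc s t ⊆ Icc 0 l := by rw [uIcc_of_le hst]; exact Icc_subset_Icc hs ht
  have hf : AbsolutelyContinuousOnInterval f s t :=
    ((innerSL ℝ w).lipschitz.comp_lipschitzOnWith
      (hC.mono hsub)).absolutelyContinuousOnInterval
  have hint := hf.integral_deriv_eq_sub
  have hfd : f t - f s = ‖w‖ * ‖w‖ := by
    simp only [f, ← map_sub, ← hw]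
    rw [innerSL_apply_apply, real_inner_self_eq_norm_mul_norm]
  have hle : ∫ r in s..t, deriv f r ≤ ∫ _ in s..t, ‖w‖ := by
    refine intervalIntegral.integral_mono_ae_restrict hst hf.intervalIntegrable_deriv
      intervalIntegrable_const ?_
    rw [← restrict_Ioo_eq_restrict_Icc]
    have hd' := ae_restrict_of_ae_restrict_of_subset (Ioo_subset_Ioo hs ht) hd
    filter_upwards [hd'] with r hr
    have hdiff : DifferentiableAt ℝ γ r := by
      by_contra hnd
      rw [deriv_zero_of_not_differentiableAt hnd] at hr
      simp at hr
    have : deriv f r = innerSL ℝ w (deriv γ r) :=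
      ((innerSL ℝ w).hasFDerivAt.comp_hasDerivAt r hdiff.hasDerivAt).deriv
    rw [this, innerSL_apply_apply]
    simpa [hr] using real_inner_le_norm w (deriv γ r)
  rw [hint, hfd, intervalIntegral.integral_const, smul_eq_mul] at hle
  rcases (norm_nonneg w).eq_or_lt with h0 | h0
  · rw [← h0]; linarith
  · exact le_of_mul_le_mul_right hle h0

theorem dist_le (h : IsPath U x y l γ) : ‖y - x‖ ≤ l := by
  simpa [h.2.2.2.1, h.2.2.2.2.1] using h.norm_sub_le le_rfl h.1 le_rfl

theorem subpath (h : IsPath U x y l γ) {a b : ℝ} (ha : 0 ≤ a) (hab : a ≤ b) (hb : b ≤ l)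
    (hV : ∀ s ∈ Icc a b, γ s ∈ V) : IsPath V (γ a) (γ b) (b - a) (fun s => γ (s + a)) := by
  obtain ⟨-, ⟨C, hC⟩, -, -, -, hd⟩ := h
  refine ⟨sub_nonneg.2 hab, ⟨C, fun s hs t ht => ?_⟩, fun s hs => hV _ ⟨by linarith [hs.1], by
    linarith [hs.2]⟩, by simp, by simp, ?_⟩
  · simpa using hC (x := s + a) ⟨by linarith [hs.1], by linarith [hs.2]⟩
      (y := t + a) ⟨by linarith [ht.1], by linarith [ht.2]⟩
  · have h1 := ae_restrict_of_ae_restrict_of_subset (Ioo_subset_Ioo ha hb) hd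
    rw [ae_restrict_iff' measurableSet_Ioo] at h1 ⊢
    have h2 := (measurePreserving_add_right (volume : Measure ℝ) a).quasiMeasurePreserving.ae h1
    filter_upwards [h2] with s hs hs'
    rw [deriv_comp_add_const]
    exact hs ⟨by linarith [hs'.1], by linarith [hs'.2]⟩

theorem pathDist_subpath_le (h : IsPath U x y l γ) {a b : ℝ} (ha : 0 ≤ a) (hab : a ≤ b)
    (hb : b ≤ l) (hV : ∀ s ∈ Icc a b, γ s ∈ V) :
    pathDist H V ν (γ a) (γ b) ≤ finslerLength H ν γ a b := by
  have := (h.subpath ha hab hb hV).pathDist_le (H := H) (ν := ν)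
  rwa [finslerLength_shift, zero_add, sub_add_cancel] at this

theorem concat {l' : ℝ} {γ' : ℝ → Rn n} (h : IsPath U x y l γ) (h' : IsPath U y z l' γ') :
    IsPath U x z (l + l') (fun s => if s ≤ l then γ s else γ' (s - l)) := by
  have hl := h.1
  have hl' := h'.1
  have hyl := h.2.2.2.2.1
  have hy0 := h'.2.2.2.1
  have key : ∀ s t, 0 ≤ s → s ≤ t → t ≤ l + l' →
      ‖(if t ≤ l then γ t else γ' (t - l)) - (if s ≤ l then γ s else γ' (s - l))‖ ≤ t - s := by
    intro s t hs hst ht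
    by_cases h1 : t ≤ l
    · rw [if_pos h1, if_pos (hst.trans h1)]
      exact h.norm_sub_le hs hst h1
    · rw [if_neg h1]
      push Not at h1
      by_cases h2 : s ≤ l
      · rw [if_pos h2]
        have e1 := h.norm_sub_le hs h2 le_rfl
        have e2 := h'.norm_sub_le le_rfl (sub_nonneg.2 h1.le) (by linarith)
        rw [hyl] at e1
        rw [hy0] at e2
        have := norm_sub_le_norm_sub_add_norm_sub (γ' (t - l)) y (γ s)
        linarith
      · rw [if_neg h2]
        push Not at h2
        have := h'.norm_sub_le (sub_nonneg.2 h2.le) (sub_le_sub_right hst l)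
          (by linarith)
        linarith
  refine ⟨by linarith, ⟨1, LipschitzOnWith.of_dist_le_mul fun s hs t ht => ?_⟩,
    fun s hs => ?_, ?_, ?_, ?_⟩
  · rw [NNReal.coe_one, one_mul, dist_eq_norm, Real.dist_eq]
    rcases le_total s t with hst | hst
    · rw [norm_sub_rev, abs_sub_comm, abs_of_nonneg (sub_nonneg.2 hst)]
      exact key s t hs.1 hst ht.2
    · rw [abs_of_nonneg (sub_nonneg.2 hst)]
      exact key t s ht.1 hst hs.2
  · by_cases h1 : s ≤ l
    · simp only [if_pos h1]; exact h.2.2.1 s ⟨hs.1, h1⟩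
    · simp only [if_neg h1]
      push Not at h1
      exact h'.2.2.1 _ ⟨by linarith, by linarith [hs.2]⟩
  · simp only [if_pos hl]; exact h.2.2.2.1
  · by_cases h1 : l + l' ≤ l
    · have : l' = 0 := le_antisymm (by linarith) hl'
      have e := h'.2.2.2.2.1
      simp only [if_pos h1]
      rw [this, add_zero, hyl, ← hy0]
      rw [this] at e; exact e
    · simp only [if_neg h1, add_sub_cancel_left]; exact h'.2.2.2.2.1
  · have e1 := h.2.2.2.2.2
    have e2 := h'.2.2.2.2.2
    rw [ae_restrict_iff' measurableSet_Ioo] at e1 e2 ⊢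
    have e3 := (measurePreserving_sub_right (volume : Measure ℝ) l).quasiMeasurePreserving.ae e2
    have e4 : ∀ᵐ s : ℝ, s ≠ l := by simp [ae_iff, measure_singleton]
    filter_upwards [e1, e3, e4] with s h1 h2 h3 hs
    rcases lt_or_gt_of_ne h3 with hlt | hgt
    · have : (fun s => if s ≤ l then γ s else γ' (s - l)) =ᶠ[𝓝 s] γ := by
        filter_upwards [gt_mem_nhds hlt] with r hr
        rw [if_pos hr.le]
      rw [this.deriv_eq]
      exact h1 ⟨hs.1, hlt⟩
    · have : (fun s => if s ≤ l then γ s else γ' (s - l)) =ᶠ[𝓝 s] fun r => γ' (r - l) := by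
        filter_upwards [lt_mem_nhds hgt] with r hr
        rw [if_neg (not_le.2 hr)]
      rw [this.deriv_eq, deriv_comp_sub_const]
      exact h2 ⟨by linarith, by linarith [hs.2]⟩

theorem finslerLength_concat {l' : ℝ} {γ' : ℝ → Rn n} (h : 0 ≤ l) (h' : 0 ≤ l') :
    finslerLength H ν (fun s => if s ≤ l then γ s else γ' (s - l)) 0 (l + l') =
      finslerLength H ν γ 0 l + finslerLength H ν γ' 0 l' := by
  rw [← finslerLength_add_adjacent h (by linarith : l ≤ l + l')]
  congr 1
  · exact finslerLength_congr fun s hs => if_pos hs.2.le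
  · have h1 := finslerLength_shift (H := H) (ν := ν) (γ := γ') l (l + l') (-l)
    rw [add_neg_cancel, add_neg_cancel_comm] at h1
    rw [← h1]
    exact finslerLength_congr fun s hs => if_neg (not_le.2 hs.1)

theorem reverse (h : IsPath U x y l γ) : IsPath U y x l (fun s => γ (l - s)) := by
  obtain ⟨hl, ⟨C, hC⟩, hU, h0, h1, hd⟩ := h
  refine ⟨hl, ⟨C, fun s hs t ht => ?_⟩, fun s hs => hU _ ⟨by linarith [hs.2], by linarith [hs.1]⟩,
    by simpa using h1, by simpa using h0, ?_⟩
  · have := hC (x := l - s) ⟨by linarith [hs.2], by linarith [hs.1]⟩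
      (y := l - t) ⟨by linarith [ht.2], by linarith [ht.1]⟩
    simpa [edist_sub_left] using this
  · rw [ae_restrict_iff' measurableSet_Ioo] at hd ⊢
    have h2 := (Measure.measurePreserving_sub_left (volume : Measure ℝ)
      l).quasiMeasurePreserving.ae hd
    filter_upwards [h2] with s hs hs'
    rw [deriv_comp_const_sub, norm_neg]
    exact hs ⟨by linarith [hs'.2], by linarith [hs'.1]⟩

theorem length_add_le (h : IsPath U x y l γ) {α : ℝ}
    (hα : ∀ x ∈ U, ∀ q, supportFun H ν x q + ENNReal.ofReal (α * ‖q‖) ≤ supportFun H ν' x q) :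
    finslerLength H ν γ 0 l + ENNReal.ofReal (α * l) ≤ finslerLength H ν' γ 0 l := by
  obtain ⟨hl, -, hU, -, -, hd⟩ := h
  rw [ofReal_mul_eq_lintegral hl, finslerLength, ← lintegral_add_right _ measurable_const]
  refine lintegral_mono_ae ?_
  filter_upwards [hd, ae_restrict_mem measurableSet_Ioo] with s hs hs'
  simpa [hs] using hα (γ s) (hU s (Ioo_subset_Icc_self hs')) (deriv γ s)

theorem length_le_add (h : IsPath U x y l γ) {α : ℝ}
    (hα : ∀ x ∈ U, ∀ q, supportFun H ν' x q ≤ supportFun H ν x q + ENNReal.ofReal (α * ‖q‖)) :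
    finslerLength H ν' γ 0 l ≤ finslerLength H ν γ 0 l + ENNReal.ofReal (α * l) := by
  obtain ⟨hl, -, hU, -, -, hd⟩ := h
  rw [ofReal_mul_eq_lintegral hl, finslerLength, finslerLength,
    ← lintegral_add_right _ measurable_const]
  refine lintegral_mono_ae ?_
  filter_upwards [hd, ae_restrict_mem measurableSet_Ioo] with s hs hs'
  simpa [hs] using hα (γ s) (hU s (Ioo_subset_Icc_self hs')) (deriv γ s)

theorem length_ge (h : IsPath U x y l γ) {α : ℝ}
    (hα : ∀ x ∈ U, ∀ q, ENNReal.ofReal (α * ‖q‖) ≤ supportFun H ν x q) :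
    ENNReal.ofReal (α * l) ≤ finslerLength H ν γ 0 l := by
  obtain ⟨hl, -, hU, -, -, hd⟩ := h
  rw [ofReal_mul_eq_lintegral hl, finslerLength]
  refine lintegral_mono_ae ?_
  filter_upwards [hd, ae_restrict_mem measurableSet_Ioo] with s hs hs'
  simpa [hs] using hα (γ s) (hU s (Ioo_subset_Icc_self hs')) (deriv γ s)

end IsPath

theorem pathDist_triangle : pathDist H U ν x z ≤ pathDist H U ν x y + pathDist H U ν y z := by
  refine ENNReal.le_of_forall_pos_le_add fun ε hε hlt => ?_
  have hε' : (ε / 2 : ℝ≥0∞) ≠ 0 := by simpa using hε.ne'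
  obtain ⟨l, γ, hγ, hγl⟩ := exists_isPath_of_pathDist_lt
    (ENNReal.lt_add_right (ne_top_of_le_ne_top hlt.ne le_self_add) hε')
  obtain ⟨l', γ', hγ', hγl'⟩ := exists_isPath_of_pathDist_lt
    (ENNReal.lt_add_right (ne_top_of_le_ne_top hlt.ne le_add_self) hε')
  calc pathDist H U ν x z ≤ _ := (hγ.concat hγ').pathDist_le
    _ = _ := IsPath.finslerLength_concat hγ.1 hγ'.1
    _ ≤ (pathDist H U ν x y + ε / 2) + (pathDist H U ν y z + ε / 2) := add_le_add hγl.le hγl'.le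
    _ = pathDist H U ν x y + pathDist H U ν y z + ε := by
      rw [add_add_add_comm, ENNReal.add_halves]

theorem finslerLength_reflect :
    finslerLength (reflect H) ν (fun s => γ (l - s)) 0 l = finslerLength H ν γ 0 l := by
  have h := (Measure.measurePreserving_sub_left (volume : Measure ℝ)
    l).setLIntegral_comp_preimage_emb (Homeomorph.subLeft l).measurableEmbedding
    (fun s => supportFun H ν (γ s) (deriv γ s)) (Ioo 0 l)
  rw [finslerLength, finslerLength, ← h]
  simp [deriv_comp_const_sub, supportFun_reflect]

theorem pathDist_reflect : pathDist (reflect H) U ν x y = pathDist H U ν y x := by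
  have key : ∀ (H : Rn n → Rn n → ℝ) (x y : Rn n),
      pathDist (reflect H) U ν x y ≤ pathDist H U ν y x := fun H x y =>
    le_pathDist fun l γ hγ => finslerLength_reflect (H := H) ▸ hγ.reverse.pathDist_le
  refine le_antisymm (key H x y) ?_
  have := key (reflect H) y x
  rwa [reflect_reflect] at this

theorem closureDist_reflect : closureDist (reflect H) Ω ν x y = closureDist H Ω ν y x := by
  have key : ∀ (H : Rn n → Rn n → ℝ) (x y : Rn n),
      closureDist (reflect H) Ω ν x y ≤ closureDist H Ω ν y x := fun H x y => by
    by_cases h : x ∈ Ω ∧ y ∈ Ω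
    · rw [closureDist, closureDist, if_pos h, if_pos h.symm, pathDist_reflect]
    · rw [closureDist, closureDist, if_neg h, if_neg fun h' => h h'.symm]
      refine le_iInf fun a => le_iInf fun b => le_iInf fun ha => le_iInf fun hb =>
        le_iInf fun hay => le_iInf fun hbx => ?_
      refine iInf_le_of_le b <| iInf_le_of_le a <| iInf_le_of_le hb <| iInf_le_of_le ha <|
        iInf_le_of_le hbx <| iInf_le_of_le hay ?_
      simp only [pathDist_reflect, le_refl]
  refine le_antisymm (key H x y) ?_
  have := key (reflect H) y x
  rwa [reflect_reflect] at this

theorem supportFun_smul {t : ℝ} (ht : 0 ≤ t) (x q : Rn n) :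
    supportFun H ν x (t • q) = ENNReal.ofReal t * supportFun H ν x q := by
  simp only [supportFun, ENNReal.mul_iSup, real_inner_smul_right, ENNReal.ofReal_mul ht]

theorem pathDist_self (hx : x ∈ U) : pathDist H U ν x x = 0 := by
  have : IsPath U x x 0 (fun _ => x) :=
    ⟨le_rfl, ⟨0, (LipschitzWith.const x).lipschitzOnWith⟩, fun _ _ => hx, rfl, rfl, by simp⟩
  simpa [finslerLength] using this.pathDist_le (H := H) (ν := ν)

theorem pathDist_le_of_segment {c : ℝ≥0∞} (hs : segment ℝ x y ⊆ U)
    (h : ∀ z ∈ segment ℝ x y, supportFun H ν z (y - x) ≤ c) : pathDist H U ν x y ≤ c := by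
  rcases eq_or_ne x y with rfl | hxy
  · rw [pathDist_self (hs (left_mem_segment ℝ x x))]; exact zero_le
  set l := ‖y - x‖ with hl
  have hl0 : 0 < l := norm_pos_iff.2 (sub_ne_zero.2 hxy.symm)
  set e := l⁻¹ • (y - x) with he
  have hen : ‖e‖ = 1 := by
    rw [he, norm_smul, norm_inv, Real.norm_of_nonneg hl0.le, ← hl, inv_mul_cancel₀ hl0.ne']
  have hmem : ∀ s ∈ Icc 0 l, x + s • e ∈ segment ℝ x y := fun s hs' => by
    rw [segment_eq_image']
    refine ⟨s * l⁻¹, ⟨by have := hs'.1; positivity, ?_⟩, by simp [he, smul_smul]⟩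
    rw [mul_inv_le_iff₀ hl0, one_mul]; exact hs'.2
  have hder : ∀ s, HasDerivAt (fun s : ℝ => x + s • e) e s := fun s => by
    simpa using ((hasDerivAt_id s).smul_const e).const_add x
  have hpath : IsPath U x y l (fun s => x + s • e) := by
    refine ⟨hl0.le, ⟨1, LipschitzOnWith.of_dist_le_mul fun s _ t _ => ?_⟩,
      fun s hs' => hs (hmem s hs'), by simp, by simp [he, hl0.ne'], ?_⟩
    · simp [dist_eq_norm, ← sub_smul, norm_smul, hen]
    · exact Eventually.of_forall fun s => by rw [(hder s).deriv, hen]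
  refine hpath.pathDist_le.trans ?_
  calc finslerLength H ν (fun s => x + s • e) 0 l
      ≤ ∫⁻ _ in Ioo 0 l, ENNReal.ofReal l⁻¹ * c := by
        refine setLIntegral_mono measurable_const fun s hs' => ?_
        rw [(hder s).deriv, he, supportFun_smul (by positivity)]
        gcongr
        exact h _ (hmem s (Ioo_subset_Icc_self hs'))
    _ = c := by
        rw [setLIntegral_const, Real.volume_Ioo, sub_zero, mul_right_comm,
          ← ENNReal.ofReal_mul (by positivity), inv_mul_cancel₀ hl0.ne', ENNReal.ofReal_one,
          one_mul]

theorem IsSupremand.exists_pathDist_le (hH : IsSupremand Ω H) (hν : ν ≠ ⊤) :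
    ∃ M : ℝ, 0 ≤ M ∧ ∀ U ⊆ Ω, ∀ x y, segment ℝ x y ⊆ U →
      pathDist H U ν x y ≤ ENNReal.ofReal (M * ‖y - x‖) := by
  obtain ⟨M, hM, h⟩ := hH.exists_norm_le hν
  exact ⟨M, hM, fun U hU x y hs => pathDist_le_of_segment hs fun z hz =>
    supportFun_le_of_norm_le (h z (hU (hs hz))) _⟩

theorem IsSupremand.pathDist_top (hH : IsSupremand Ω H) (hU : U ⊆ Ω) (hxy : x ≠ y) :
    pathDist H U ⊤ x y = ⊤ := by
  refine top_unique (le_pathDist fun l γ hγ => ?_)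
  have hl : 0 < l := (norm_pos_iff.2 (sub_ne_zero.2 hxy.symm)).trans_le hγ.dist_le
  have : finslerLength H ⊤ γ 0 l = ∫⁻ _ in Ioo 0 l, ⊤ := by
    refine lintegral_congr_ae ?_
    filter_upwards [hγ.2.2.2.2.2, ae_restrict_mem measurableSet_Ioo] with s hs hs'
    refine hH.supportFun_top (hU (hγ.2.2.1 s (Ioo_subset_Icc_self hs'))) ?_
    intro h0; rw [h0] at hs; simp at hs
  rw [this, setLIntegral_const, Real.volume_Ioo, sub_zero,
    ENNReal.top_mul (by simpa using hl)]

/-! ### Weak gradients -/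

theorem MemW1Inf.isWeakGradient (h : MemW1Inf V u) : IsWeakGradient V u (weakGradient V u) := by
  have := h.2
  rw [weakGradient, dif_pos this]
  exact this.choose_spec

theorem ae_supFunctional_le {v : Rn n → ℝ} (h : supFunctional H V v ≤ ν) :
    ∀ᵐ x ∂(volume.restrict V), weakGradient V v x ∈ sublevel H ν x := by
  filter_upwards [ENNReal.ae_le_essSup (μ := volume.restrict V)
    (fun x => ENNReal.ofReal (H x (weakGradient V v x)))] with x hx
  exact le_trans hx h

theorem IsWeakGradient.mono (h : IsWeakGradient V u G) (hWV : W ⊆ V) : IsWeakGradient W u G := by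
  refine ⟨h.1.mono_measure (Measure.restrict_mono hWV le_rfl), fun φ hφ hc hs w => ?_⟩
  have key := h.2 φ hφ hc (hs.trans hWV) w
  have h1 : ∀ x, x ∉ W → u x * fderiv ℝ φ x w = 0 := fun x hx => by
    rw [image_eq_zero_of_notMem_tsupport (f := fderiv ℝ φ)
      (fun hx' => hx (hs (tsupport_fderiv_subset ℝ hx')))]
    simp
  have h2 : ∀ x, x ∉ W → φ x * inner ℝ (G x) w = 0 := fun x hx => by
    rw [image_eq_zero_of_notMem_tsupport (fun hx' => hx (hs hx')), zero_mul]
  rw [setIntegral_eq_integral_of_forall_compl_eq_zero fun x hx => h1 x fun hx' => hx (hWV hx'),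
    setIntegral_eq_integral_of_forall_compl_eq_zero fun x hx => h2 x fun hx' => hx (hWV hx')] at key
  rwa [setIntegral_eq_integral_of_forall_compl_eq_zero h1,
    setIntegral_eq_integral_of_forall_compl_eq_zero h2]

theorem IsWeakGradient.congr {v : Rn n → ℝ} (h : IsWeakGradient V u G) (hV : MeasurableSet V)
    (huv : EqOn u v V) : IsWeakGradient V v G := by
  refine ⟨h.1, fun φ hφ hc hs w => ?_⟩
  rw [← h.2 φ hφ hc hs w]
  exact setIntegral_congr_fun hV fun x hx => by simp only [huv hx]

theorem IsWeakGradient.integrable_smul (h : IsWeakGradient V u G) {φ : Rn n → ℝ}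
    (hφ : Continuous φ) (hc : HasCompactSupport φ) :
    Integrable (fun x => φ x • G x) (volume.restrict V) :=
  (hφ.integrable_of_hasCompactSupport hc).integrableOn.smul_of_top_left h.1

theorem IsWeakGradient.ae_eq {G' : Rn n → Rn n} (hV : IsOpen V) (h : IsWeakGradient V u G)
    (h' : IsWeakGradient V u G') : ∀ᵐ x ∂(volume.restrict V), G x = G' x := by
  rw [ae_restrict_iff' hV.measurableSet]
  have hloc : LocallyIntegrableOn (fun x => G x - G' x) V volume :=
    locallyIntegrableOn_of_locallyIntegrable_restrict
      ((h.1.sub h'.1).locallyIntegrable le_top)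
  have := hV.ae_eq_zero_of_integral_contDiff_smul_eq_zero hloc fun φ hφ hc hs => ?_
  · filter_upwards [this] with x hx hxV using sub_eq_zero.1 (hx hxV)
  rw [← setIntegral_eq_integral_of_forall_compl_eq_zero (s := V) fun x hx => by
    rw [image_eq_zero_of_notMem_tsupport (fun hx' => hx (hs hx')), zero_smul]]
  simp only [smul_sub]
  rw [integral_sub (h.integrable_smul hφ.continuous hc) (h'.integrable_smul hφ.continuous hc),
    sub_eq_zero]
  refine ext_inner_left ℝ fun w => ?_
  rw [← integral_inner (h.integrable_smul hφ.continuous hc),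
    ← integral_inner (h'.integrable_smul hφ.continuous hc)]
  have e := (h.2 φ hφ hc hs w).symm.trans (h'.2 φ hφ hc hs w)
  simpa [inner_smul_right, real_inner_comm w] using e

theorem inner_gradient (x w : Rn n) : inner ℝ (gradient u x) w = fderiv ℝ u x w := by
  rw [gradient, InnerProductSpace.toDual_symm_apply]

theorem isWeakGradient_of_lipschitzWith {C : ℝ≥0} (hu : LipschitzWith C u) (V : Set (Rn n)) :
    IsWeakGradient V u (gradient u) := by
  refine IsWeakGradient.mono (V := univ) ⟨?_, fun φ hφ hc _ w => ?_⟩ (subset_univ V)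
  · refine memLp_top_of_bound ?_ C (Eventually.of_forall fun x => ?_)
    · exact ((InnerProductSpace.toDual ℝ (Rn n)).symm.continuous.measurable.comp
        (measurable_fderiv ℝ u)).aestronglyMeasurable
    · rw [gradient, LinearIsometryEquiv.norm_map]
      exact norm_fderiv_le_of_lipschitz ℝ hu
  · obtain ⟨D, hD⟩ := ContDiff.lipschitzWith_of_hasCompactSupport hc hφ (by simp)
    have key := hu.integral_lineDeriv_mul_eq (μ := volume) hD hc w
    simp only [Measure.restrict_univ]
    have e1 : ∫ x, φ x * inner ℝ (gradient u x) w = ∫ x, lineDeriv ℝ u x w * φ x := by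
      refine integral_congr_ae ?_
      filter_upwards [hu.ae_differentiableAt (μ := volume)] with x hx
      rw [inner_gradient, hx.lineDeriv_eq_fderiv, mul_comm]
    have e2 : ∀ x, lineDeriv ℝ φ x (-w) * u x = -(u x * fderiv ℝ φ x w) := fun x => by
      rw [(hφ.differentiable (by simp) x).lineDeriv_eq_fderiv, map_neg]
      ring
    rw [e1, key]
    simp only [e2, integral_neg, neg_neg]

/-! ### From a bound on the weak gradient to a bound along curves -/

/-- `u` grows along curves of `W` by at most their Finsler length. For an open `W` this is the
metric form of `F(u, W) ≤ ν`. Points that no curve of `W` joins have distance `⊤`, so the condition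
is void for them, in particular for points outside `W`. -/
def SubFinsler (H : Rn n → Rn n → ℝ) (W : Set (Rn n)) (ν : ℝ≥0∞) (u : Rn n → ℝ) : Prop :=
  ∀ x y, ENNReal.ofReal (u y - u x) ≤ pathDist H W ν x y

open scoped Convolution in
/-- The mollification on scale `ρ` of the function equal to `u` on `V` and to `0` elsewhere. -/
def mollify (ρ : ContDiffBump (0 : Rn n)) (V : Set (Rn n)) (u : Rn n → ℝ) : Rn n → ℝ :=
  (ρ.normed volume ⋆[ContinuousLinearMap.lsmul ℝ ℝ, volume] V.indicator u : Rn n → ℝ)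

theorem locallyIntegrable_indicator (hV : IsOpen V) (hu : MemLp u ∞ (volume.restrict V)) :
    LocallyIntegrable (V.indicator u) volume :=
  ((memLp_indicator_iff_restrict hV.measurableSet).2 hu).locallyIntegrable le_top

theorem contDiff_mollify (ρ : ContDiffBump (0 : Rn n)) (hV : IsOpen V)
    (hu : MemLp u ∞ (volume.restrict V)) : ContDiff ℝ 1 (mollify ρ V u) :=
  (ρ.hasCompactSupport_normed (μ := volume)).contDiff_convolution_left (n := 1) _ ρ.contDiff_normed
    (locallyIntegrable_indicator hV hu)

theorem tendsto_mollify (hV : IsOpen V) (hu : MemLp u ∞ (volume.restrict V))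
    (hc : ContinuousOn u V) (hx : x ∈ V) {ρ : ℕ → ContDiffBump (0 : Rn n)}
    (hρ : Tendsto (fun k => (ρ k).rOut) atTop (𝓝 0)) :
    Tendsto (fun k => mollify (ρ k) V u x) atTop (𝓝 (u x)) := by
  refine ContDiffBump.convolution_tendsto_right (μ := volume) (g := fun _ => V.indicator u) hρ
    (Eventually.of_forall fun _ => (locallyIntegrable_indicator hV hu).aestronglyMeasurable)
    ?_ tendsto_const_nhds
  have h1 : Tendsto (V.indicator u) (𝓝 x) (𝓝 (u x)) := by
    refine Tendsto.congr' ?_ (hc.continuousAt (hV.mem_nhds hx))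
    filter_upwards [hV.mem_nhds hx] with z hz
    rw [indicator_of_mem hz]
  exact h1.comp tendsto_snd

theorem fderiv_mollify (ρ : ContDiffBump (0 : Rn n)) (hV : IsOpen V)
    (hu : MemLp u ∞ (volume.restrict V)) (hG : IsWeakGradient V u G)
    (hx : Metric.closedBall x ρ.rOut ⊆ V) (w : Rn n) :
    fderiv ℝ (mollify ρ V u) x w = ∫ t in V, ρ.normed volume (x - t) * inner ℝ (G t) w := by
  have h1 := (ρ.hasCompactSupport_normed (μ := volume)).hasFDerivAt_convolution_left
    (L := ContinuousLinearMap.lsmul ℝ ℝ) (μ := volume) (ρ.contDiff_normed (n := 1))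
    (locallyIntegrable_indicator hV hu) x
  have hint := ((ρ.hasCompactSupport_normed (μ := volume)).fderiv ℝ).convolutionExists_left
    ((ContinuousLinearMap.lsmul ℝ ℝ).precompL (Rn n))
    ((ρ.contDiff_normed (n := 1)).continuous_fderiv one_ne_zero)
    (locallyIntegrable_indicator hV hu) x
  have h2 : fderiv ℝ (mollify ρ V u) x w =
      ∫ t, fderiv ℝ (ρ.normed volume) (x - t) w * V.indicator u t := by
    rw [show fderiv ℝ (mollify ρ V u) x = _ from h1.fderiv, convolution_eq_swap,
      ContinuousLinearMap.integral_apply]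
    · rfl
    · exact hint.integrable_swap
  -- the test function of the definition of the weak gradient
  have hψ : ContDiff ℝ ∞ fun t => ρ.normed volume (x - t) :=
    ρ.contDiff_normed.comp (contDiff_const.sub contDiff_id)
  have hder : ∀ t, fderiv ℝ (fun t => ρ.normed volume (x - t)) t w =
      - fderiv ℝ (ρ.normed volume) (x - t) w := fun t => by
    have h3 := ((ρ.contDiff_normed (μ := volume) (n := 1)).differentiable one_ne_zero
      (x - t)).hasFDerivAt.comp t ((hasFDerivAt_id t).const_sub x)
    rw [show fderiv ℝ (fun t => ρ.normed volume (x - t)) t = _ from h3.fderiv]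
    simp
  have hsupp : tsupport (fun t => ρ.normed volume (x - t)) ⊆ Metric.closedBall x ρ.rOut := by
    refine closure_minimal (fun t ht => ?_) Metric.isClosed_closedBall
    have : x - t ∈ Function.support (ρ.normed volume) := ht
    rw [ρ.support_normed_eq, mem_ball_zero_iff] at this
    rw [Metric.mem_closedBall, dist_comm, dist_eq_norm]
    exact this.le
  have hcs : HasCompactSupport fun t => ρ.normed volume (x - t) :=
    (isCompact_closedBall x ρ.rOut).of_isClosed_subset (isClosed_tsupport _) hsupp
  have key := hG.2 _ hψ hcs (hsupp.trans hx) w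
  simp only [hder, mul_neg, integral_neg, neg_inj] at key
  rw [h2, ← key, ← integral_indicator hV.measurableSet]
  refine integral_congr_ae (Eventually.of_forall fun t => ?_)
  by_cases ht : t ∈ V <;> simp [ht, mul_comm]

/-- Mollification preserves one-sided bounds on directional derivatives. -/
theorem fderiv_mollify_le (ρ : ContDiffBump (0 : Rn n)) (hV : IsOpen V)
    (hu : MemLp u ∞ (volume.restrict V)) (hG : IsWeakGradient V u G)
    (hx : Metric.closedBall x ρ.rOut ⊆ V) {w : Rn n} {b : ℝ}
    (hb : ∀ᵐ t ∂(volume.restrict V), dist t x < ρ.rOut → inner ℝ (G t) w ≤ b) :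
    fderiv ℝ (mollify ρ V u) x w ≤ b := by
  have hcont : Continuous fun t => ρ.normed volume (x - t) :=
    (ρ.contDiff_normed (n := 0)).continuous.comp (continuous_const.sub continuous_id)
  have hsupp : ∀ t, ¬ dist t x < ρ.rOut → ρ.normed volume (x - t) = 0 := fun t ht => by
    have : x - t ∉ Function.support (ρ.normed volume) := by
      rw [ρ.support_normed_eq, mem_ball_zero_iff, ← dist_eq_norm, dist_comm]
      exact ht
    simpa using this
  have hcs : HasCompactSupport fun t => ρ.normed volume (x - t) :=
    HasCompactSupport.intro (isCompact_closedBall x ρ.rOut) fun t ht =>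
      hsupp t fun h => ht h.le
  have hint : Integrable (fun t => ρ.normed volume (x - t)) volume :=
    hcont.integrable_of_hasCompactSupport hcs
  have hone : ∫ t in V, ρ.normed volume (x - t) * b = b := by
    rw [setIntegral_eq_integral_of_forall_compl_eq_zero fun t ht => by
      rw [hsupp t fun h => ht (hx (Metric.ball_subset_closedBall h)), zero_mul],
      integral_mul_const, integral_sub_left_eq_self (fun t => ρ.normed volume t) volume x,
      ρ.integral_normed, one_mul]
  rw [fderiv_mollify ρ hV hu hG hx]
  refine le_trans (integral_mono_ae ?_ (hint.integrableOn.mul_const b) ?_) hone.le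
  · have := (hG.integrable_smul hcont hcs).inner_const (𝕜 := ℝ) w
    simpa [real_inner_smul_left] using this
  · filter_upwards [hb] with t ht
    by_cases h : dist t x < ρ.rOut
    · exact mul_le_mul_of_nonneg_left (ht h) (ρ.nonneg_normed _)
    · simp [hsupp t h]

theorem ofReal_integral_le_lintegral {α : Type*} [MeasurableSpace α] {m : Measure α} {f : α → ℝ}
    (hf : Integrable f m) : ENNReal.ofReal (∫ a, f a ∂m) ≤ ∫⁻ a, ENNReal.ofReal (f a) ∂m := by
  refine ENNReal.ofReal_le_of_le_toReal ?_
  rw [integral_eq_lintegral_pos_part_sub_lintegral_neg_part hf]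
  exact sub_le_self _ ENNReal.toReal_nonneg

/-- A function whose weak gradient lies in the sublevels grows along each curve by at most the
Finsler length. Curves are null sets, so the inequality is obtained for the mollifications, where
the upper semicontinuity of the sublevels bounds the gradient asymptotically, and passes to the
limit by the reverse Fatou lemma. -/
theorem IsWeakGradient.subFinsler (hH : IsSupremand Ω H) (hν : ν ≠ ⊤) (hVΩ : V ⊆ Ω)
    (hV : IsOpen V) (hc : ContinuousOn u V) (hu : MemLp u ∞ (volume.restrict V))
    (hG : IsWeakGradient V u G) (hGν : ∀ᵐ t ∂(volume.restrict V), G t ∈ sublevel H ν t) :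
    SubFinsler H V ν u := by
  intro x y
  refine le_pathDist fun l γ hγ => ?_
  obtain ⟨M, hM, hMb⟩ := hH.exists_norm_le hν
  have hGV : ∀ᵐ t ∂(volume.restrict V), t ∈ V := ae_restrict_mem hV.measurableSet
  have hγc : IsCompact (γ '' Icc 0 l) := isCompact_Icc.image_of_continuousOn hγ.continuousOn
  obtain ⟨δ, hδ, hδV⟩ := hγc.exists_cthickening_subset_open hV
    (image_subset_iff.2 fun s hs => hγ.2.2.1 s hs)
  have hball : ∀ s ∈ Icc 0 l, Metric.closedBall (γ s) δ ⊆ V := fun s hs =>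
    (Metric.closedBall_subset_cthickening (mem_image_of_mem γ hs) δ).trans hδV
  let ρ : ℕ → ContDiffBump (0 : Rn n) := fun k =>
    ⟨δ / ((k : ℝ) + 1) / 2, δ / ((k : ℝ) + 1), by positivity, by
      have : 0 < δ / ((k : ℝ) + 1) := by positivity
      linarith⟩
  have hρδ : ∀ k, (ρ k).rOut ≤ δ := fun k => div_le_self hδ.le (by
    have : (0 : ℝ) ≤ k := k.cast_nonneg
    linarith)
  have hρ : Tendsto (fun k => (ρ k).rOut) atTop (𝓝 0) := by
    have := (tendsto_one_div_add_atTop_nhds_zero_nat (𝕜 := ℝ)).const_mul δ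
    simpa [ρ, div_eq_mul_inv] using this
  set f : ℕ → ℝ → ℝ := fun k s => deriv (fun r => mollify (ρ k) V u (γ r)) s with hf
  -- the derivative along the curve is a directional derivative of the mollification
  have hfle : ∀ s ∈ Ioo 0 l, ‖deriv γ s‖ = 1 → ∀ k b, (∀ᵐ t ∂(volume.restrict V),
      dist t (γ s) < (ρ k).rOut → inner ℝ (G t) (deriv γ s) ≤ b) → f k s ≤ b := by
    intro s hs hs1 k b hb
    have hdiff : DifferentiableAt ℝ γ s := by
      by_contra hnd
      rw [deriv_zero_of_not_differentiableAt hnd] at hs1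
      simp at hs1
    have hfd := ((contDiff_mollify (ρ k) hV hu).differentiable one_ne_zero (γ s)).hasFDerivAt
    have hder : f k s = fderiv ℝ (mollify (ρ k) V u) (γ s) (deriv γ s) :=
      (hfd.comp_hasDerivAt s hdiff.hasDerivAt).deriv
    rw [hder]
    exact fderiv_mollify_le (ρ k) hV hu hG ((Metric.closedBall_subset_closedBall (hρδ k)).trans
      (hball s (Ioo_subset_Icc_self hs))) hb
  have hbound : ∀ k, (fun s => ENNReal.ofReal (f k s)) ≤ᵐ[volume.restrict (Ioo 0 l)]
      fun _ => ENNReal.ofReal M := fun k => by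
    filter_upwards [hγ.2.2.2.2.2, ae_restrict_mem measurableSet_Ioo] with s hs1 hs
    refine ENNReal.ofReal_le_ofReal (hfle s hs hs1 k M ?_)
    filter_upwards [hGν, hGV] with t ht htV _
    refine (real_inner_le_norm _ _).trans ?_
    rw [hs1, mul_one]
    exact hMb t (hVΩ htV) _ ht
  have hlim : ∀ᵐ s ∂(volume.restrict (Ioo 0 l)),
      limsup (fun k => ENNReal.ofReal (f k s)) atTop ≤ supportFun H ν (γ s) (deriv γ s) := by
    filter_upwards [hγ.2.2.2.2.2, ae_restrict_mem measurableSet_Ioo] with s hs1 hs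
    have hγs : γ s ∈ Ω := hVΩ (hγ.2.2.1 s (Ioo_subset_Icc_self hs))
    have hfin : supportFun H ν (γ s) (deriv γ s) ≠ ⊤ :=
      ne_top_of_le_ne_top ENNReal.ofReal_ne_top (supportFun_le_of_norm_le (hMb _ hγs) _)
    refine ENNReal.le_of_forall_pos_le_add fun ε hε _ => ?_
    obtain ⟨η, hη, hnear⟩ := hH.exists_sublevel_near hν hγs (NNReal.coe_pos.2 hε)
    refine limsup_le_of_le (by isBoundedDefault) ?_
    filter_upwards [hρ.eventually (gt_mem_nhds hη)] with k hk
    rw [← ENNReal.ofReal_toReal hfin, ← ENNReal.ofReal_coe_nnreal,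
      ← ENNReal.ofReal_add ENNReal.toReal_nonneg ε.coe_nonneg]
    refine ENNReal.ofReal_le_ofReal (hfle s hs hs1 k _ ?_)
    filter_upwards [hGν, hGV] with t ht htV hdist
    have h1 := (ofReal_inner_le_supportFun ht (deriv γ s)).trans
      (supportFun_le_add (hnear t (hVΩ htV) (hdist.trans hk)) (deriv γ s))
    rw [hs1, mul_one, ← ENNReal.ofReal_toReal hfin,
      ← ENNReal.ofReal_add ENNReal.toReal_nonneg ε.coe_nonneg] at h1
    exact (ENNReal.ofReal_le_ofReal_iff (by positivity)).1 h1
  have hFTC : ∀ k, ENNReal.ofReal (mollify (ρ k) V u y - mollify (ρ k) V u x) ≤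
      ∫⁻ s in Ioo 0 l, ENNReal.ofReal (f k s) := fun k => by
    obtain ⟨C, hC⟩ := hγ.2.1
    obtain ⟨D, hD⟩ := ((contDiff_mollify (ρ k) hV hu).locallyLipschitz.locallyLipschitzOn
      (s := γ '' Icc 0 l)).exists_lipschitzOnWith_of_compact hγc
    have hac : AbsolutelyContinuousOnInterval (fun r => mollify (ρ k) V u (γ r)) 0 l := by
      refine LipschitzOnWith.absolutelyContinuousOnInterval (K := D * C) ?_
      rw [uIcc_of_le hγ.1]
      exact hD.comp hC (mapsTo_image γ _)
    have hint := hac.intervalIntegrable_deriv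
    rw [intervalIntegrable_iff_integrableOn_Ioo_of_le hγ.1] at hint
    have heq := hac.integral_deriv_eq_sub
    rw [intervalIntegral.integral_of_le hγ.1, integral_Ioc_eq_integral_Ioo, hγ.2.2.2.1,
      hγ.2.2.2.2.1] at heq
    rw [← heq]
    exact ofReal_integral_le_lintegral hint
  have hux := tendsto_mollify hV hu hc hγ.left_mem hρ
  have huy := tendsto_mollify hV hu hc hγ.right_mem hρ
  have hT := (ENNReal.continuous_ofReal.tendsto _).comp (huy.sub hux)
  calc ENNReal.ofReal (u y - u x)
      = limsup (fun k => ENNReal.ofReal (mollify (ρ k) V u y - mollify (ρ k) V u x)) atTop :=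
        hT.limsup_eq.symm
    _ ≤ limsup (fun k => ∫⁻ s in Ioo 0 l, ENNReal.ofReal (f k s)) atTop :=
        limsup_le_limsup (Eventually.of_forall hFTC)
    _ ≤ ∫⁻ s in Ioo 0 l, limsup (fun k => ENNReal.ofReal (f k s)) atTop :=
        limsup_lintegral_le (fun _ => ENNReal.ofReal M)
          (fun k => (measurable_deriv _).ennreal_ofReal) hbound (by
            rw [setLIntegral_const, Real.volume_Ioo]
            exact ENNReal.mul_ne_top ENNReal.ofReal_ne_top ENNReal.ofReal_ne_top)
    _ ≤ finslerLength H ν γ 0 l := lintegral_mono_ae hlim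

/-! ### From a bound along curves to a bound on the weak gradient -/

theorem SubFinsler.mono (h : SubFinsler H U ν u) (hWU : W ⊆ U) : SubFinsler H W ν u :=
  fun x y => (h x y).trans (pathDist_anti hWU)

theorem SubFinsler.add_const (h : SubFinsler H U ν u) (a : ℝ) :
    SubFinsler H U ν (fun x => u x + a) := fun x y => by
  simpa using h x y

theorem subFinsler_reflect : SubFinsler (reflect H) U ν u ↔ SubFinsler H U ν (-u) := by
  constructor
  · intro h x y
    simpa [pathDist_reflect, neg_add_eq_sub] using h y x
  · intro h x y
    simpa [pathDist_reflect, neg_add_eq_sub] using h y x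

theorem SubFinsler.exists_lipschitzOnWith_ball (hH : IsSupremand Ω H) (hν : ν ≠ ⊤) (hWΩ : W ⊆ Ω)
    (hu : SubFinsler H W ν u) :
    ∃ M : ℝ≥0, ∀ x r, Metric.ball x r ⊆ W → LipschitzOnWith M u (Metric.ball x r) := by
  obtain ⟨M, hM, h⟩ := hH.exists_pathDist_le hν
  refine ⟨⟨M, hM⟩, fun x r hr => LipschitzOnWith.of_le_add_mul _ fun a ha b hb => ?_⟩
  have hseg : segment ℝ b a ⊆ W := ((convex_ball x r).segment_subset hb ha).trans hr
  have h1 := (hu b a).trans (h W hWΩ b a hseg)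
  rw [ENNReal.ofReal_le_ofReal_iff (by positivity), ← dist_eq_norm] at h1
  change u a ≤ u b + M * dist a b
  linarith

theorem SubFinsler.locallyLipschitzOn (hH : IsSupremand Ω H) (hν : ν ≠ ⊤) (hWΩ : W ⊆ Ω)
    (hW : IsOpen W) (hu : SubFinsler H W ν u) : LocallyLipschitzOn W u := by
  obtain ⟨M, hM⟩ := hu.exists_lipschitzOnWith_ball hH hν hWΩ
  intro x hx
  obtain ⟨r, hr, hrW⟩ := Metric.isOpen_iff.1 hW x hx
  exact ⟨M, Metric.ball x r, mem_nhdsWithin_of_mem_nhds (Metric.ball_mem_nhds x hr), hM x r hrW⟩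

/-- At a point of differentiability, the bound along short segments puts the gradient into the
half-spaces that cut out the sublevel. -/
theorem SubFinsler.gradient_mem_sublevel (hH : IsSupremand Ω H) (hν : ν ≠ ⊤) (hWΩ : W ⊆ Ω)
    (hW : IsOpen W) (hu : SubFinsler H W ν u) (hx : x ∈ W) (hd : DifferentiableAt ℝ u x) :
    gradient u x ∈ sublevel H ν x := by
  refine hH.mem_sublevel_of_inner_le hν (hWΩ hx) fun q => ?_
  rw [inner_gradient]
  refine ENNReal.le_of_forall_pos_le_add fun ε hε _ => ?_
  have hε' : (0 : ℝ) < ε / (‖q‖ + 1) := div_pos (NNReal.coe_pos.2 hε) (by positivity)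
  obtain ⟨δ, hδ, hnear⟩ := hH.exists_sublevel_near hν (hWΩ hx) hε'
  have hεq : ENNReal.ofReal (ε / (‖q‖ + 1) * ‖q‖) ≤ ε := by
    rw [← ENNReal.ofReal_coe_nnreal]
    refine ENNReal.ofReal_le_ofReal ?_
    rw [div_mul_eq_mul_div, div_le_iff₀ (by positivity)]
    nlinarith [ε.coe_nonneg]
  obtain ⟨r, hr, hrW⟩ := Metric.isOpen_iff.1 hW x hx
  have hT := (hd.hasFDerivAt.hasLineDerivAt q).tendsto_slope_zero_right
  have hT' := (ENNReal.continuous_ofReal.tendsto _).comp hT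
  refine le_of_tendsto hT' ?_
  have hev : ∀ᶠ s : ℝ in 𝓝[>] 0, s * ‖q‖ < min δ r := by
    have : Tendsto (fun s : ℝ => s * ‖q‖) (𝓝 0) (𝓝 (0 * ‖q‖)) := tendsto_id.mul_const _
    rw [zero_mul] at this
    exact (this.mono_left nhdsWithin_le_nhds).eventually (gt_mem_nhds (lt_min hδ hr))
  filter_upwards [hev, self_mem_nhdsWithin] with s hs (hs0 : 0 < s)
  have hseg : ∀ z ∈ segment ℝ x (x + s • q), dist z x < min δ r := fun z hz => by
    refine lt_of_le_of_lt ?_ hs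
    rw [segment_eq_image'] at hz
    obtain ⟨t, ⟨ht0, ht1⟩, rfl⟩ := hz
    simp only [add_sub_cancel_left, dist_eq_norm, norm_smul, Real.norm_of_nonneg ht0,
      Real.norm_of_nonneg hs0.le]
    exact mul_le_of_le_one_left (by positivity) ht1
  have hsegW : segment ℝ x (x + s • q) ⊆ W := fun z hz =>
    hrW ((hseg z hz).trans_le (min_le_right _ _))
  have h1 := (hu x (x + s • q)).trans <| pathDist_le_of_segment hsegW
    (c := ENNReal.ofReal s * (supportFun H ν x q + ε)) fun z hz => by
      rw [add_sub_cancel_left, supportFun_smul hs0.le]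
      gcongr
      refine (supportFun_le_add (hnear z (hWΩ (hsegW hz))
        ((hseg z hz).trans_le (min_le_left _ _))) q).trans ?_
      gcongr
  simp only [Function.comp_apply, smul_eq_mul]
  rw [ENNReal.ofReal_mul (by positivity)]
  calc ENNReal.ofReal s⁻¹ * ENNReal.ofReal (u (x + s • q) - u x)
      ≤ ENNReal.ofReal s⁻¹ * (ENNReal.ofReal s * (supportFun H ν x q + ε)) := by gcongr
    _ = supportFun H ν x q + ε := by
      rw [← mul_assoc, ← ENNReal.ofReal_mul (by positivity), inv_mul_cancel₀ hs0.ne',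
        ENNReal.ofReal_one, one_mul]

theorem SubFinsler.ae_mem_sublevel (hH : IsSupremand Ω H) (hν : ν ≠ ⊤) (hWΩ : W ⊆ Ω)
    (hW : IsOpen W) (hu : SubFinsler H W ν u) (hG : IsWeakGradient W u G) :
    ∀ᵐ t ∂(volume.restrict W), G t ∈ sublevel H ν t := by
  rw [ae_restrict_iff' hW.measurableSet, ae_iff]
  obtain ⟨M, hM⟩ := hu.exists_lipschitzOnWith_ball hH hν hWΩ
  refine measure_null_of_locally_null _ fun x hx => ?_
  have hxW : x ∈ W := by by_contra h; exact hx fun h' => absurd h' h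
  obtain ⟨r, hr, hrW⟩ := Metric.isOpen_iff.1 hW x hxW
  refine ⟨Metric.ball x r ∩ {a | ¬(a ∈ W → G a ∈ sublevel H ν a)},
    inter_mem (mem_nhdsWithin_of_mem_nhds (Metric.ball_mem_nhds x hr)) self_mem_nhdsWithin, ?_⟩
  obtain ⟨f, hf, hfu⟩ := (hM x r hrW).extend_real
  have hfu' : EqOn u f (Metric.ball x r) := hfu
  have hae := ((hG.mono hrW).congr Metric.isOpen_ball.measurableSet hfu').ae_eq
    Metric.isOpen_ball (isWeakGradient_of_lipschitzWith hf (Metric.ball x r))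
  rw [ae_restrict_iff' Metric.isOpen_ball.measurableSet] at hae
  have : ∀ᵐ a : Rn n, ¬ (a ∈ Metric.ball x r ∩ {a | ¬(a ∈ W → G a ∈ sublevel H ν a)}) := by
    filter_upwards [hae, hf.ae_differentiableAt (μ := volume)] with a ha hda
    rintro ⟨har, hna⟩
    refine hna fun haW => ?_
    have heq : u =ᶠ[𝓝 a] f := hfu'.eventuallyEq_of_mem (Metric.isOpen_ball.mem_nhds har)
    have hgrad : gradient f a = gradient u a := by rw [gradient, gradient, heq.fderiv_eq]
    rw [ha har, hgrad]
    exact hu.gradient_mem_sublevel hH hν hWΩ hW haW (hda.congr_of_eventuallyEq heq)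
  simpa only [ae_iff, not_not, Set.ofPred_mem_eq] using this

theorem SubFinsler.supFunctional_le (hH : IsSupremand Ω H) (hν : ν ≠ ⊤) (hWΩ : W ⊆ Ω)
    (hW : IsOpen W) (hu : SubFinsler H W ν u) (hu' : MemW1Inf W u) : supFunctional H W u ≤ ν :=
  essSup_le_of_ae_le _ (hu.ae_mem_sublevel hH hν hWΩ hW hu'.isWeakGradient)

theorem memW1InfC_of_lipschitzOnWith (hW : IsOpen W) (hWc : IsCompact (closure W)) {C : ℝ≥0}
    (hu : LipschitzOnWith C u (closure W)) : MemW1InfC W u := by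
  obtain ⟨f, hf, hfu⟩ := hu.extend_real
  obtain ⟨b, hb⟩ := hWc.exists_bound_of_continuousOn hu.continuousOn
  refine ⟨⟨memLp_top_of_bound ((hu.continuousOn.mono subset_closure).aestronglyMeasurable
    hW.measurableSet) b ?_, _, (isWeakGradient_of_lipschitzWith hf W).congr hW.measurableSet
      fun x hx => (hfu (subset_closure hx)).symm⟩, hu.continuousOn⟩
  filter_upwards [ae_restrict_mem hW.measurableSet] with x hx using hb x (subset_closure hx)

/-! ### Absolute minimizers in metric form -/

/-- The metric form of absolute minimality: on an open set `W`, compactly contained in `Ω`, the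
function `u` inherits the bound along curves from every competitor with the same values on the
boundary of `W`. Competitors are defined on a neighbourhood `U` of the closure of `W`. -/
structure IsMetricAbsoluteMinimizer (H : Rn n → Rn n → ℝ) (Ω : Set (Rn n)) (u : Rn n → ℝ) :
    Prop where
  continuousOn : ContinuousOn u Ω
  subFinsler : ∀ (W U : Set (Rn n)) (ν : ℝ≥0∞) (c : Rn n → ℝ), IsOpen W → IsOpen U →
    closure W ⊆ U → U ⊆ Ω → ν ≠ ⊤ → SubFinsler H U ν c → EqOn u c (frontier W) →
      SubFinsler H W ν u

theorem IsMetricAbsoluteMinimizer.reflect (hu : IsMetricAbsoluteMinimizer H Ω u) :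
    IsMetricAbsoluteMinimizer (reflect H) Ω (-u) where
  continuousOn := hu.continuousOn.neg
  subFinsler W U ν c hW hU hWU hUΩ hν hc hcu := by
    rw [subFinsler_reflect, neg_neg]
    rw [subFinsler_reflect] at hc
    exact hu.subFinsler W U ν (-c) hW hU hWU hUΩ hν hc fun x hx => by
      simpa using congrArg Neg.neg (hcu hx)

theorem IsAbsoluteMinimizer.isMetricAbsoluteMinimizer (hH : IsSupremand Ω H)
    (hbdd : Bornology.IsBounded Ω) (hu : IsAbsoluteMinimizer H Ω g u) :
    IsMetricAbsoluteMinimizer H Ω u where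
  continuousOn := hu.1.1.2.mono subset_closure
  subFinsler W U ν c hW hU hWU hUΩ hν hc hcu := by
    have hWΩ : W ⊆ Ω := (subset_closure.trans hWU).trans hUΩ
    have hWc : IsCompact (closure W) := (hbdd.subset hWΩ).isCompact_closure
    obtain ⟨C, hC⟩ := ((hc.locallyLipschitzOn hH hν hUΩ hU).mono
      hWU).exists_lipschitzOnWith_of_compact hWc
    have hcW := memW1InfC_of_lipschitzOnWith hW hWc hC
    have hF := (hu.2 W hW (hWU.trans hUΩ) c hcW hcu).trans
      ((hc.mono (subset_closure.trans hWU)).supFunctional_le hH hν hWΩ hW hcW.1)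
    have huW : MemW1Inf W u := ⟨hu.1.1.1.1.mono_measure (Measure.restrict_mono hWΩ le_rfl), _,
      hu.1.1.1.isWeakGradient.mono hWΩ⟩
    exact huW.isWeakGradient.subFinsler hH hν hWΩ hW
      (hu.1.1.2.mono (hWΩ.trans subset_closure)) huW.1 (ae_supFunctional_le hF)

/-! ### Absolute minimizers are minimizers -/

theorem MemW1InfC.subFinsler (hH : IsSupremand Ω H) (hΩ : IsOpen Ω) (hν : ν ≠ ⊤)
    (hu : MemW1InfC Ω u) (hF : supFunctional H Ω u ≤ ν) : SubFinsler H Ω ν u :=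
  hu.1.isWeakGradient.subFinsler hH hν subset_rfl hΩ (hu.2.mono subset_closure) hu.1.1
    (ae_supFunctional_le hF)

/-- Where `u` exceeds a competitor by more than `δ`, the bound along curves passes to `u`. -/
theorem IsMetricAbsoluteMinimizer.subFinsler_setOf_lt (hu : IsMetricAbsoluteMinimizer H Ω u)
    (hΩ : IsOpen Ω) (hν : ν ≠ ⊤) (hv : SubFinsler H Ω ν v) (huc : ContinuousOn u (closure Ω))
    (hvc : ContinuousOn v (closure Ω)) (huv : EqOn u v (frontier Ω)) {δ : ℝ} (hδ : 0 < δ) :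
    SubFinsler H {x | x ∈ Ω ∧ v x + δ < u x} ν u := by
  set W := {x | x ∈ Ω ∧ v x + δ < u x} with hWdef
  have hWo : IsOpen W := by
    have : W = Ω ∩ (fun x => u x - v x) ⁻¹' Ioi δ := by
      ext x
      simp [hWdef, lt_sub_iff_add_lt, add_comm]
    rw [this]
    exact ((huc.sub hvc).mono subset_closure).isOpen_inter_preimage hΩ isOpen_Ioi
  have hWcl : closure W ⊆ closure Ω := closure_mono fun x hx => hx.1
  have hle : ∀ x ∈ closure W, v x + δ ≤ u x := fun x hx =>
    le_on_closure (f := fun x => v x + δ) (fun z hz => hz.2.le)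
      ((hvc.add continuousOn_const).mono hWcl) (huc.mono hWcl) hx
  have hWΩ : closure W ⊆ Ω := fun x hx => by
    by_contra hxΩ
    have hfr : x ∈ frontier Ω := ⟨hWcl hx, fun h => hxΩ (interior_subset h)⟩
    have := hle x hx
    rw [huv hfr] at this
    linarith
  refine hu.subFinsler W Ω ν (fun x => v x + δ) hWo hΩ hWΩ subset_rfl hν (hv.add_const δ) ?_
  intro x hx
  rw [hWo.frontier_eq] at hx
  refine le_antisymm ?_ (hle x hx.1)
  by_contra hlt
  exact hx.2 ⟨hWΩ hx.1, not_le.1 hlt⟩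

theorem ofReal_sub_le_of_Ico {f : ℝ → ℝ} {a b : ℝ} {C : ℝ≥0∞} (hab : a ≤ b)
    (hf : ContinuousOn f (Icc a b)) (h : ∀ s ∈ Ico a b, ENNReal.ofReal (f s - f a) ≤ C) :
    ENNReal.ofReal (f b - f a) ≤ C := by
  rcases hab.eq_or_lt with rfl | hlt
  · simp
  have hcl : closure (Ico a b) = Icc a b := closure_Ico hlt.ne
  exact le_on_closure (f := fun s => ENNReal.ofReal (f s - f a)) h
    (hcl ▸ ENNReal.continuous_ofReal.comp_continuousOn (hf.sub continuousOn_const))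
    continuousOn_const (hcl ▸ right_mem_Icc.2 hab)

theorem ofReal_sub_le_of_Ioc {f : ℝ → ℝ} {a b : ℝ} {C : ℝ≥0∞} (hab : a ≤ b)
    (hf : ContinuousOn f (Icc a b)) (h : ∀ s ∈ Ioc a b, ENNReal.ofReal (f b - f s) ≤ C) :
    ENNReal.ofReal (f b - f a) ≤ C := by
  rcases hab.eq_or_lt with rfl | hlt
  · simp
  have hcl : closure (Ioc a b) = Icc a b := closure_Ioc hlt.ne
  exact le_on_closure (f := fun s => ENNReal.ofReal (f b - f s)) h
    (hcl ▸ ENNReal.continuous_ofReal.comp_continuousOn (continuousOn_const.sub hf))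
    continuousOn_const (hcl ▸ left_mem_Icc.2 hab)

/-- A competitor with the same boundary values on `Ω` itself, which is not an admissible set in the
definition of absolute minimality, also passes its bound to `u`. A curve is cut at the first and at
the last zero of `u - v`: between them the increments of `u` and `v` agree, and before and after
them the curve stays in `{u > v}` or in `{u < v}`. -/
theorem IsMetricAbsoluteMinimizer.subFinsler_of_eqOn_frontier
    (hu : IsMetricAbsoluteMinimizer H Ω u)
    (hΩ : IsOpen Ω) (hν : ν ≠ ⊤) (hv : SubFinsler H Ω ν v) (huc : ContinuousOn u (closure Ω))
    (hvc : ContinuousOn v (closure Ω)) (huv : EqOn u v (frontier Ω)) : SubFinsler H Ω ν u := by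
  intro x y
  refine le_pathDist fun l γ hγ => ?_
  have hγΩ : MapsTo γ (Icc 0 l) Ω := hγ.2.2.1
  have hucγ : ContinuousOn (fun s => u (γ s)) (Icc 0 l) :=
    (huc.mono subset_closure).comp hγ.continuousOn hγΩ
  have hvcγ : ContinuousOn (fun s => v (γ s)) (Icc 0 l) :=
    (hvc.mono subset_closure).comp hγ.continuousOn hγΩ
  set w : ℝ → ℝ := fun s => u (γ s) - v (γ s) with hw
  have hwc : ContinuousOn w (Icc 0 l) := hucγ.sub hvcγ
  have hpos : ∀ a b, 0 ≤ a → a ≤ b → b ≤ l → (∀ s ∈ Icc a b, 0 < w s) →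
      ENNReal.ofReal (u (γ b) - u (γ a)) ≤ finslerLength H ν γ a b := by
    intro a b ha hab hb hs
    have hsub : Icc a b ⊆ Icc 0 l := Icc_subset_Icc ha hb
    obtain ⟨m, hm, hmin⟩ := isCompact_Icc.exists_isMinOn (nonempty_Icc.2 hab) (hwc.mono hsub)
    refine (hu.subFinsler_setOf_lt hΩ hν hv huc hvc huv (half_pos (hs m hm)) _ _).trans
      (hγ.pathDist_subpath_le ha hab hb fun s hs' => ⟨hγΩ (hsub hs'), ?_⟩)
    have h1 : w m ≤ w s := hmin hs'
    have h2 := hs m hm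
    have h3 : w s = u (γ s) - v (γ s) := rfl
    linarith
  have hneg : ∀ a b, 0 ≤ a → a ≤ b → b ≤ l → (∀ s ∈ Icc a b, w s < 0) →
      ENNReal.ofReal (u (γ b) - u (γ a)) ≤ finslerLength H ν γ a b := by
    intro a b ha hab hb hs
    have hsub : Icc a b ⊆ Icc 0 l := Icc_subset_Icc ha hb
    obtain ⟨m, hm, hmax⟩ := isCompact_Icc.exists_isMaxOn (nonempty_Icc.2 hab) (hwc.mono hsub)
    have hv' : SubFinsler (Supremal.reflect H) Ω ν (-v) := by rwa [subFinsler_reflect, neg_neg]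
    have key := hu.reflect.subFinsler_setOf_lt hΩ hν hv' huc.neg hvc.neg
      (fun z hz => congrArg Neg.neg (huv hz)) (half_pos (neg_pos.2 (hs m hm)))
    rw [subFinsler_reflect, neg_neg] at key
    refine (key _ _).trans
      (hγ.pathDist_subpath_le ha hab hb fun s hs' => ⟨hγΩ (hsub hs'), ?_⟩)
    have h1 : w s ≤ w m := hmax hs'
    have h2 := hs m hm
    have h3 : w s = u (γ s) - v (γ s) := rfl
    simp only [Pi.neg_apply]
    linarith
  have hne : ∀ a b, 0 ≤ a → a ≤ b → b ≤ l → (∀ s ∈ Icc a b, w s ≠ 0) →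
      ENNReal.ofReal (u (γ b) - u (γ a)) ≤ finslerLength H ν γ a b := by
    intro a b ha hab hb hs
    have hsub : Icc a b ⊆ Icc 0 l := Icc_subset_Icc ha hb
    have hconn : (w '' Icc a b).OrdConnected :=
      (isPreconnected_Icc.image w (hwc.mono hsub)).ordConnected
    have haI : a ∈ Icc a b := left_mem_Icc.2 hab
    rcases lt_or_gt_of_ne (hs a haI) with h0 | h0
    · refine hneg a b ha hab hb fun s hs' => ?_
      by_contra hcon
      obtain ⟨t, ht, ht0⟩ := hconn.out (mem_image_of_mem w haI) (mem_image_of_mem w hs')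
        ⟨h0.le, not_lt.1 hcon⟩
      exact hs t ht ht0
    · refine hpos a b ha hab hb fun s hs' => ?_
      by_contra hcon
      obtain ⟨t, ht, ht0⟩ := hconn.out (mem_image_of_mem w hs') (mem_image_of_mem w haI)
        ⟨not_lt.1 hcon, h0.le⟩
      exact hs t ht ht0
  rw [← hγ.2.2.2.1, ← hγ.2.2.2.2.1]
  by_cases hZ : ∃ s ∈ Icc 0 l, w s = 0
  · have hZc : IsCompact (Icc 0 l ∩ w ⁻¹' {0}) :=
      isCompact_Icc.of_isClosed_subset
        (hwc.preimage_isClosed_of_isClosed isClosed_Icc isClosed_singleton) inter_subset_left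
    have hZne : (Icc 0 l ∩ w ⁻¹' {0}).Nonempty := let ⟨s, hs, hs0⟩ := hZ; ⟨s, hs, hs0⟩
    obtain ⟨a, ⟨haI, ha0⟩, hamin⟩ := hZc.exists_isLeast hZne
    obtain ⟨b, ⟨hbI, hb0⟩, hbmax⟩ := hZc.exists_isGreatest hZne
    have hab : a ≤ b := hamin ⟨hbI, hb0⟩
    have h1 : ENNReal.ofReal (u (γ a) - u (γ 0)) ≤ finslerLength H ν γ 0 a :=
      ofReal_sub_le_of_Ico (f := fun s => u (γ s)) haI.1
        (hucγ.mono (Icc_subset_Icc_right haI.2)) fun s hs =>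
        (hne 0 s le_rfl hs.1 (hs.2.le.trans haI.2) fun t ht ht0 => absurd
          (hamin ⟨⟨ht.1, ht.2.trans (hs.2.le.trans haI.2)⟩, ht0⟩)
          (not_le.2 (ht.2.trans_lt hs.2))).trans (finslerLength_mono le_rfl hs.2.le)
    have h3 : ENNReal.ofReal (u (γ l) - u (γ b)) ≤ finslerLength H ν γ b l :=
      ofReal_sub_le_of_Ioc (f := fun s => u (γ s)) hbI.2
        (hucγ.mono (Icc_subset_Icc_left hbI.1)) fun s hs =>
        (hne s l (hbI.1.trans hs.1.le) hs.2 le_rfl fun t ht ht0 => absurd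
          (hbmax ⟨⟨(hbI.1.trans hs.1.le).trans ht.1, ht.2⟩, ht0⟩)
          (not_le.2 (hs.1.trans_le ht.1))).trans (finslerLength_mono hs.1.le le_rfl)
    have h2 : ENNReal.ofReal (u (γ b) - u (γ a)) ≤ finslerLength H ν γ a b := by
      have e : u (γ b) - u (γ a) = v (γ b) - v (γ a) := by
        have e1 : u (γ a) - v (γ a) = 0 := ha0
        have e2 : u (γ b) - v (γ b) = 0 := hb0
        linarith
      rw [e]
      exact (hv _ _).trans (hγ.pathDist_subpath_le haI.1 hab hbI.2 fun s hs =>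
        hγΩ ⟨haI.1.trans hs.1, hs.2.trans hbI.2⟩)
    rw [← finslerLength_add_adjacent haI.1 haI.2, ← finslerLength_add_adjacent hab hbI.2]
    calc ENNReal.ofReal (u (γ l) - u (γ 0))
        = ENNReal.ofReal ((u (γ a) - u (γ 0)) + ((u (γ b) - u (γ a)) + (u (γ l) - u (γ b)))) := by
          congr 1; ring
      _ ≤ _ := ENNReal.ofReal_add_le.trans (add_le_add h1
          (ENNReal.ofReal_add_le.trans (add_le_add h2 h3)))
  · push Not at hZ
    exact hne 0 l le_rfl hγ.1 le_rfl hZ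

theorem IsAbsoluteMinimizer.supFunctional_eq (hH : IsSupremand Ω H) (hΩ : IsOpen Ω)
    (hbdd : Bornology.IsBounded Ω) (hu : IsAbsoluteMinimizer H Ω g u) :
    supFunctional H Ω u = minValue H Ω g := by
  refine le_antisymm (le_of_forall_gt fun ν hν => ?_) (iInf₂_le u hu.1)
  simp only [minValue, iInf_lt_iff] at hν
  obtain ⟨v, hv, hvν⟩ := hν
  have hne : supFunctional H Ω v ≠ ⊤ := hvν.ne_top
  refine lt_of_le_of_lt ?_ hvν
  refine SubFinsler.supFunctional_le hH hne subset_rfl hΩ ?_ hu.1.1.1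
  exact (hu.isMetricAbsoluteMinimizer hH hbdd).subFinsler_of_eqOn_frontier hΩ hne
    (hv.1.subFinsler hH hΩ hne le_rfl) hu.1.1.2 hv.1.2
    fun z hz => (hu.1.2 z hz).trans (hv.2 z hz).symm

theorem IsAbsoluteMinimizer.subFinsler (hH : IsSupremand Ω H) (hΩ : IsOpen Ω)
    (hbdd : Bornology.IsBounded Ω) (hu : IsAbsoluteMinimizer H Ω g u) :
    SubFinsler H Ω (minValue H Ω g) u := by
  rcases eq_or_ne (minValue H Ω g) ⊤ with h | h
  · intro x y
    rcases eq_or_ne x y with rfl | hxy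
    · simp
    · rw [h, hH.pathDist_top subset_rfl hxy]
      exact le_top
  · exact hu.1.1.subFinsler hH hΩ h (hu.supFunctional_eq hH hΩ hbdd).le

/-! ### Comparison with cones -/

theorem IsMetricAbsoluteMinimizer.le_pathDist_of_frontier (hu : IsMetricAbsoluteMinimizer H Ω u)
    (hH : IsSupremand Ω H) (hν : ν ≠ ⊤) (hB : IsOpen B) (hB' : IsOpen B')
    (hBB' : closure B ⊆ B') (hB'Ω : B' ⊆ Ω)
    (hfr : ∀ x ∈ frontier B, ENNReal.ofReal (u x - u x₀) ≤ pathDist H B' ν x₀ x) :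
    ∀ x ∈ B, ENNReal.ofReal (u x - u x₀) ≤ pathDist H B' ν x₀ x := by
  obtain ⟨M, hM, hMd⟩ := hH.exists_pathDist_le hν
  set d : Rn n → ℝ≥0∞ := fun x => pathDist H B' ν x₀ x with hd
  -- the cone is finite, and a competitor, on the open set `U` of points reachable from `x₀`
  set U : Set (Rn n) := {x | x ∈ B' ∧ d x < ⊤} with hUdef
  have hball : ∀ x r, Metric.ball x r ⊆ B' → ∀ a ∈ Metric.ball x r, ∀ b ∈ Metric.ball x r,
      d a < ⊤ → d b < ⊤ := fun x r hr a ha b hb hda =>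
    lt_of_le_of_lt pathDist_triangle (ENNReal.add_lt_top.2 ⟨hda, lt_of_le_of_lt
      (hMd B' hB'Ω a b (((convex_ball x r).segment_subset ha hb).trans hr))
      ENNReal.ofReal_lt_top⟩)
  have hUo : IsOpen U := Metric.isOpen_iff.2 fun x hx => by
    obtain ⟨r, hr, hrB⟩ := Metric.isOpen_iff.1 hB' x hx.1
    exact ⟨r, hr, fun z hz => ⟨hrB hz, hball x r hrB x (Metric.mem_ball_self hr) z hz hx.2⟩⟩
  have hUΩ : U ⊆ Ω := fun x hx => hB'Ω hx.1
  set c : Rn n → ℝ := fun x => (d x).toReal + u x₀ with hc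
  have hcU : SubFinsler H U ν c := fun x y => le_pathDist fun l γ hγ => by
    have hx := hγ.left_mem
    have hy := hγ.right_mem
    simp only [hc, add_sub_add_right_eq_sub]
    rw [ENNReal.ofReal_sub _ ENNReal.toReal_nonneg, ENNReal.ofReal_toReal hx.2.ne,
      ENNReal.ofReal_toReal hy.2.ne, tsub_le_iff_left]
    refine pathDist_triangle.trans (add_le_add le_rfl ?_)
    exact (pathDist_anti fun x hx => hx.1).trans hγ.pathDist_le
  have hcc : ContinuousOn c U := (hcU.locallyLipschitzOn hH hν hUΩ hUo).continuousOn
  have huc : ContinuousOn u U := hu.continuousOn.mono hUΩ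
  set W : Set (Rn n) := (B ∩ U) ∩ (fun x => u x - c x) ⁻¹' Ioi 0 with hW
  have hWo : IsOpen W := ((huc.sub hcc).mono inter_subset_right).isOpen_inter_preimage
    (hB.inter hUo) isOpen_Ioi
  have hWU : closure W ⊆ U := fun x hx => by
    have hxB' : x ∈ B' := hBB' (closure_mono (fun z hz => hz.1.1) hx)
    obtain ⟨r, hr, hrB⟩ := Metric.isOpen_iff.1 hB' x hxB'
    obtain ⟨z, hz, hzW⟩ := mem_closure_iff.1 hx _ Metric.isOpen_ball (Metric.mem_ball_self hr)
    exact ⟨hxB', hball x r hrB z hz x (Metric.mem_ball_self hr) hzW.1.2.2⟩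
  have hge : ∀ x ∈ closure W, c x ≤ u x := fun x hx =>
    le_on_closure (f := c) (fun z hz => (sub_pos.1 hz.2).le) (hcc.mono hWU) (huc.mono hWU) hx
  have heq : EqOn u c (frontier W) := fun x hx => by
    rw [hWo.frontier_eq] at hx
    have hxU := hWU hx.1
    refine le_antisymm ?_ (hge x hx.1)
    by_cases hxB : x ∈ B
    · by_contra hlt
      exact hx.2 ⟨⟨hxB, hxU⟩, sub_pos.2 (not_le.1 hlt)⟩
    · have hxf : x ∈ frontier B := by
        rw [hB.frontier_eq]
        exact ⟨closure_mono (fun z hz => hz.1.1) hx.1, hxB⟩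
      have := hfr x hxf
      rw [ENNReal.ofReal_le_iff_le_toReal hxU.2.ne] at this
      simp only [hc]
      linarith
  have huW := hu.subFinsler W U ν c hWo hUo hWU hUΩ hν hcU heq
  intro x hxB
  by_contra! hlt
  obtain ⟨l, γ, hγ, hγl⟩ := exists_isPath_of_pathDist_lt hlt
  refine absurd hγl (not_lt.2 ?_)
  have hxU : x ∈ U := ⟨hγ.right_mem, hlt.trans_le le_top⟩
  have hxW : x ∈ W := by
    refine ⟨⟨hxB, hxU⟩, ?_⟩
    change 0 < u x - c x
    rw [sub_pos]
    have := (ENNReal.lt_ofReal_iff_toReal_lt hxU.2.ne).1 hlt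
    simp only [hc, hd]
    linarith
  have hx₀B' : x₀ ∈ B' := hγ.left_mem
  have hx₀W : x₀ ∉ W := fun h => by
    have : 0 < u x₀ - c x₀ := h.2
    simp [hc, hd, pathDist_self hx₀B'] at this
  -- the last parameter at which the curve is outside `W`
  obtain ⟨t, ⟨htI, htW⟩, htmax⟩ := (isCompact_Icc.of_isClosed_subset
    (hγ.continuousOn.preimage_isClosed_of_isClosed isClosed_Icc hWo.isClosed_compl)
    inter_subset_left).exists_isGreatest ⟨0, left_mem_Icc.2 hγ.1, by
      change γ 0 ∈ Wᶜ
      rw [hγ.2.2.2.1]; exact hx₀W⟩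
  have hγW : ∀ s ∈ Ioc t l, γ s ∈ W := fun s hs => by
    by_contra h
    exact absurd (htmax ⟨⟨htI.1.trans hs.1.le, hs.2⟩, h⟩) (not_le.2 hs.1)
  have htl : t < l := by
    refine lt_of_le_of_ne htI.2 fun h => htW ?_
    rw [h, hγ.2.2.2.2.1]; exact hxW
  have hucγ : ContinuousOn (fun s => u (γ s)) (Icc 0 l) :=
    hu.continuousOn.comp hγ.continuousOn fun s hs => hB'Ω (hγ.2.2.1 s hs)
  have htcl : γ t ∈ closure W := by
    have h1 : ContinuousWithinAt γ (Ioc t l) t :=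
      (hγ.continuousOn t htI).mono fun s hs => ⟨htI.1.trans hs.1.le, hs.2⟩
    refine h1.mem_closure ?_ hγW
    rw [closure_Ioc htl.ne]
    exact left_mem_Icc.2 htl.le
  have h1 : ENNReal.ofReal (u (γ t) - u x₀) ≤ finslerLength H ν γ 0 t := by
    rw [heq (by rw [hWo.frontier_eq]; exact ⟨htcl, htW⟩)]
    simp only [hc, add_sub_cancel_right]
    rw [ENNReal.ofReal_toReal (hWU htcl).2.ne, hd]
    have := hγ.pathDist_subpath_le (H := H) (ν := ν) le_rfl htI.1 htI.2
      (fun s hs => hγ.2.2.1 s ⟨hs.1, hs.2.trans htI.2⟩)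
    rwa [hγ.2.2.2.1] at this
  have h2 : ENNReal.ofReal (u (γ l) - u (γ t)) ≤ finslerLength H ν γ t l :=
    ofReal_sub_le_of_Ioc (f := fun s => u (γ s)) htI.2
      (hucγ.mono (Icc_subset_Icc_left htI.1)) fun s hs =>
      (huW _ _).trans ((hγ.pathDist_subpath_le (htI.1.trans hs.1.le) hs.2 le_rfl
        fun r hr => hγW r ⟨hs.1.trans_le hr.1, hr.2⟩).trans (finslerLength_mono hs.1.le le_rfl))
  rw [← finslerLength_add_adjacent htI.1 htI.2]
  rw [hγ.2.2.2.2.1] at h2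
  calc ENNReal.ofReal (u x - u x₀) = ENNReal.ofReal ((u (γ t) - u x₀) + (u x - u (γ t))) := by
        congr 1; ring
    _ ≤ _ := ENNReal.ofReal_add_le.trans (add_le_add h1 h2)

/-! ### Points of maximal slope -/

/-- At `x₀` the function `u` has upward slope at least `μ`: at every lower level the cone with
vertex `x₀` is exceeded by `u` arbitrarily close to `x₀`. -/
def SteepAt (H : Rn n → Rn n → ℝ) (Ω : Set (Rn n)) (u : Rn n → ℝ) (μ : ℝ≥0∞) (x₀ : Rn n) : Prop :=
  ∀ ν < μ, ∀ r : ℝ, 0 < r → ∃ x ∈ Metric.ball x₀ r,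
    pathDist H Ω ν x₀ x < ENNReal.ofReal (u x - u x₀)

theorem pointwiseH_eq_iff_steepAt (hu : SubFinsler H Ω μ u)
    (hx₀ : 0 < Metric.infDist x₀ (frontier Ω)) :
    pointwiseH H Ω u x₀ = μ ↔ SteepAt H Ω u μ x₀ := by
  constructor
  · intro h ν hν r hr
    by_contra! hcon
    set r' := min r (Metric.infDist x₀ (frontier Ω) / 2) with hr'
    have h1 : localLevel H Ω u x₀ r' ≤ ν := sInf_le fun x hx =>
      hcon x (Metric.ball_subset_ball (min_le_left _ _) hx)
    have h2 : pointwiseH H Ω u x₀ ≤ localLevel H Ω u x₀ r' :=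
      iInf_le_of_le r' <| iInf_le_of_le (by positivity) <|
        iInf_le _ ((min_le_right _ _).trans_lt (by linarith))
    exact absurd hν (not_lt.2 (h ▸ h2.trans h1))
  · intro h
    refine le_antisymm ?_ ?_
    · refine iInf_le_of_le (Metric.infDist x₀ (frontier Ω) / 2) <| iInf_le_of_le (by positivity) <|
        iInf_le_of_le (by linarith) <| sInf_le fun x _ => hu x₀ x
    · refine le_iInf fun r => le_iInf fun hr => le_iInf fun _ => le_sInf fun ν hν => ?_
      by_contra! hlt
      obtain ⟨x, hx, hxlt⟩ := h ν hlt r hr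
      exact absurd hxlt (not_lt.2 (hν x hx))

/-- If `u` lies below a cone at a level `ν` near its vertex, then comparison with cones having
nearby vertices, at a higher level, bounds `u` near the vertex from below as well. Hence the upward
and the downward slope of an absolute minimizer agree. -/
theorem IsMetricAbsoluteMinimizer.exists_reverse_le_pathDist
    (hu : IsMetricAbsoluteMinimizer H Ω u) (hH : IsSupremand Ω H) (hΩ : IsOpen Ω) (hx₀ : x₀ ∈ Ω)
    (hνν' : ν < ν') (hν' : ν' ≠ ⊤) {r : ℝ} (hr : 0 < r)
    (h : ∀ y ∈ Metric.ball x₀ r, ENNReal.ofReal (u y - u x₀) ≤ pathDist H Ω ν x₀ y) :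
    ∃ r' : ℝ, 0 < r' ∧ ∀ x ∈ Metric.ball x₀ r',
      ENNReal.ofReal (u x₀ - u x) ≤ pathDist H Ω ν' x x₀ := by
  obtain ⟨α, hα, hgap⟩ := hH.exists_supportFun_add_le hνν'
  obtain ⟨M, hM, hMd⟩ := hH.exists_pathDist_le hν'
  obtain ⟨R, hR, hRΩ⟩ := Metric.isOpen_iff.1 hΩ x₀ hx₀
  set ρ : ℝ := min R r / 2 with hρ
  have hρ0 : 0 < ρ := by positivity
  have hρR : ρ < R := (half_lt_self (by positivity)).trans_le (min_le_left _ _)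
  have hρr : ρ < r := (half_lt_self (by positivity)).trans_le (min_le_right _ _)
  have hη : 0 < α * ρ / 2 := by positivity
  obtain ⟨r₁, hr₁, hcont⟩ := Metric.continuousAt_iff.1
    (hu.continuousOn.continuousAt (hΩ.mem_nhds hx₀)) _ hη
  refine ⟨min ρ (min r₁ (α * ρ / 2 / (M + 1))), by positivity, fun x hx => ?_⟩
  rw [Metric.mem_ball, lt_min_iff, lt_min_iff] at hx
  obtain ⟨hxρ, hxr₁, hxM⟩ := hx
  have hclΩ : closure (Metric.ball x₀ ρ) ⊆ Ω :=
    Metric.closure_ball_subset_closedBall.trans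
      ((Metric.closedBall_subset_ball hρR).trans hRΩ)
  refine hu.le_pathDist_of_frontier hH hν' Metric.isOpen_ball hΩ hclΩ subset_rfl
    (fun y hy => ?_) x₀ (Metric.mem_ball_self hρ0)
  have hyρ : dist y x₀ = ρ := Metric.frontier_ball_subset_sphere hy
  have h1 : pathDist H Ω ν x₀ y + ENNReal.ofReal (α * ρ) ≤ pathDist H Ω ν' x₀ y :=
    le_pathDist fun l γ hγ => by
      refine le_trans (add_le_add hγ.pathDist_le (ENNReal.ofReal_le_ofReal ?_))
        (hγ.length_add_le hgap)
      have := hγ.dist_le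
      rw [← dist_eq_norm, hyρ] at this
      gcongr
  have hseg : segment ℝ x₀ x ⊆ Ω :=
    ((convex_ball x₀ ρ).segment_subset (Metric.mem_ball_self hρ0) hxρ).trans
      (subset_closure.trans hclΩ)
  have h2 : pathDist H Ω ν' x₀ x ≤ ENNReal.ofReal (α * ρ / 2) := by
    refine (hMd Ω subset_rfl x₀ x hseg).trans (ENNReal.ofReal_le_ofReal ?_)
    rw [← dist_eq_norm]
    rw [lt_div_iff₀ (by positivity)] at hxM
    nlinarith [dist_nonneg (x := x) (y := x₀)]
  have h3 : u x₀ - u x ≤ α * ρ / 2 := by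
    have := hcont hxr₁
    rw [Real.dist_eq, abs_lt] at this
    linarith
  have hsum : ENNReal.ofReal (α * ρ / 2) + ENNReal.ofReal (α * ρ / 2) = ENNReal.ofReal (α * ρ) := by
    rw [← ENNReal.ofReal_add hη.le hη.le, add_halves]
  refine (ENNReal.add_le_add_iff_right (ENNReal.ofReal_ne_top (r := α * ρ))).1 ?_
  calc ENNReal.ofReal (u y - u x) + ENNReal.ofReal (α * ρ)
      ≤ (ENNReal.ofReal (u y - u x₀) + ENNReal.ofReal (α * ρ / 2)) + ENNReal.ofReal (α * ρ) := by
        gcongr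
        refine le_trans (ENNReal.ofReal_le_ofReal ?_) ENNReal.ofReal_add_le
        linarith
    _ ≤ (pathDist H Ω ν x₀ y + ENNReal.ofReal (α * ρ / 2)) + ENNReal.ofReal (α * ρ) := by
        gcongr
        exact h y (by rw [Metric.mem_ball, hyρ]; exact hρr)
    _ = (pathDist H Ω ν x₀ y + ENNReal.ofReal (α * ρ)) + ENNReal.ofReal (α * ρ / 2) :=
        add_right_comm _ _ _
    _ ≤ (ENNReal.ofReal (α * ρ / 2) + pathDist H Ω ν' x y) + ENNReal.ofReal (α * ρ / 2) := by
        refine add_le_add ?_ le_rfl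
        exact h1.trans (pathDist_triangle.trans (add_le_add h2 le_rfl))
    _ = pathDist H Ω ν' x y + ENNReal.ofReal (α * ρ) := by
        rw [← hsum]; ring

theorem SteepAt.reflect (h : SteepAt H Ω u μ x₀) (hu : IsMetricAbsoluteMinimizer H Ω u)
    (hH : IsSupremand Ω H) (hΩ : IsOpen Ω) (hx₀ : x₀ ∈ Ω) :
    SteepAt (reflect H) Ω (-u) μ x₀ := by
  intro ν hν r hr
  by_contra! hcon
  obtain ⟨ν', hνν', hν'⟩ := exists_between hν
  obtain ⟨r', hr', hle⟩ := hu.reflect.exists_reverse_le_pathDist hH.reflect hΩ hx₀ hνν'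
    hν'.ne_top hr hcon
  obtain ⟨x, hx, hlt⟩ := h ν' hν' r' hr'
  have := hle x hx
  rw [pathDist_reflect] at this
  simp only [Pi.neg_apply, neg_sub_neg] at this
  exact absurd hlt (not_lt.2 this)

/-! ### Reaching the boundary from a point of maximal slope -/

/-- Close to `x₀` short curves cannot leave a neighbourhood `B'`, so the excess over the cone
persists for the distance of `B'`. -/
theorem SteepAt.exists_mem (h : SteepAt H Ω u μ x₀) (hH : IsSupremand Ω H)
    (hΩ : IsOpen Ω) (huc : ContinuousOn u Ω) (hν : ν < μ) (hν0 : 0 < ν)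
    (hB : IsOpen B) (hBB' : B ⊆ B') (hB'Ω : B' ⊆ Ω) (hx₀ : x₀ ∈ B) :
    ∃ x ∈ B, pathDist H B' ν x₀ x < ENNReal.ofReal (u x - u x₀) := by
  obtain ⟨α, hα, hαφ⟩ := hH.exists_le_supportFun hν0
  obtain ⟨R, hR, hRB⟩ := Metric.isOpen_iff.1 hB x₀ hx₀
  obtain ⟨r, hr, hcont⟩ := Metric.continuousAt_iff.1
    (huc.continuousAt (hΩ.mem_nhds (hB'Ω (hBB' hx₀)))) (α * R) (by positivity)
  obtain ⟨x, hx, hlt⟩ := h ν hν r hr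
  obtain ⟨l, γ, hγ, hγl⟩ := exists_isPath_of_pathDist_lt hlt
  have hux : u x - u x₀ < α * R := by
    have := hcont hx
    rw [Real.dist_eq, abs_lt] at this
    exact this.2
  have hl : l < R := by
    have h1 := (hγ.length_ge hαφ).trans_lt (hγl.trans_le (ENNReal.ofReal_le_ofReal hux.le))
    rw [ENNReal.ofReal_lt_ofReal_iff (by positivity)] at h1
    exact lt_of_mul_lt_mul_left h1 hα.le
  have hγR : ∀ s ∈ Icc 0 l, γ s ∈ Metric.ball x₀ R := fun s hs => by
    have := hγ.norm_sub_le le_rfl hs.1 hs.2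
    rw [hγ.2.2.2.1, sub_zero] at this
    rw [mem_ball_iff_norm]
    exact this.trans_lt (hs.2.trans_lt hl)
  refine ⟨x, hRB ?_, ?_⟩
  · have := hγR l (right_mem_Icc.2 hγ.1)
    rwa [hγ.2.2.2.2.1] at this
  · have := hγ.pathDist_subpath_le (H := H) (ν := ν) le_rfl hγ.1 le_rfl
      fun s hs => hBB' (hRB (hγR s hs))
    rw [hγ.2.2.2.1, hγ.2.2.2.2.1] at this
    exact this.trans_lt hγl

/-- Comparison with cones moves the excess to the boundary of any neighbourhood of `x₀`. -/
theorem SteepAt.exists_mem_frontier (h : SteepAt H Ω u μ x₀) (hH : IsSupremand Ω H)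
    (hΩ : IsOpen Ω) (hu : IsMetricAbsoluteMinimizer H Ω u) (hν : ν < μ) (hν0 : 0 < ν)
    (hB : IsOpen B) (hB' : IsOpen B') (hBB' : closure B ⊆ B') (hB'Ω : B' ⊆ Ω)
    (hx₀ : x₀ ∈ B) : ∃ x ∈ frontier B, pathDist H B' ν x₀ x < ENNReal.ofReal (u x - u x₀) := by
  by_contra! hcon
  obtain ⟨x, hx, hlt⟩ := h.exists_mem hH hΩ hu.continuousOn hν hν0 hB
    (subset_closure.trans hBB') hB'Ω hx₀
  exact absurd hlt (not_lt.2
    (hu.le_pathDist_of_frontier hH hν.ne_top hB hB' hBB' hB'Ω hcon x hx))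

/-- Slopes are finite at interior points: on compact sets large levels contain large balls of
gradients, so that their cones exceed any oscillation. -/
theorem SteepAt.ne_top (h : SteepAt H Ω u μ x₀) (hH : IsSupremand Ω H)
    (hΩ : IsOpen Ω) (hu : IsMetricAbsoluteMinimizer H Ω u) (hx₀ : x₀ ∈ Ω) : μ ≠ ⊤ := by
  rintro rfl
  obtain ⟨R, hR, hRΩ⟩ := Metric.nhds_basis_closedBall.mem_iff.1 (hΩ.mem_nhds hx₀)
  obtain ⟨Q, hQ⟩ := (isCompact_closedBall x₀ R).exists_bound_of_continuousOn
    (hu.continuousOn.mono hRΩ)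
  set C : ℝ := 2 * Q / (R / 2) with hC
  obtain ⟨ν, hν, hK⟩ := hH.exists_closedBall_subset_sublevel (isCompact_closedBall x₀ R) hRΩ C
  have hQ0 : 0 ≤ Q := (norm_nonneg _).trans (hQ x₀ (Metric.mem_closedBall_self hR.le))
  have hC0 : 0 ≤ C := by positivity
  obtain ⟨x, hx, hlt⟩ := h.exists_mem_frontier hH hΩ hu (ν := max ν 1)
    (max_lt hν.lt_top ENNReal.one_lt_top) (by simp) (Metric.isOpen_ball (x := x₀) (ε := R / 2))
    (Metric.isOpen_ball (x := x₀) (ε := R))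
    (Metric.closure_ball_subset_closedBall.trans
      (Metric.closedBall_subset_ball (half_lt_self hR)))
    (Metric.ball_subset_closedBall.trans hRΩ) (Metric.mem_ball_self (half_pos hR))
  have hxR : dist x x₀ = R / 2 := Metric.frontier_ball_subset_sphere hx
  have hφ : ∀ y ∈ Metric.ball x₀ R, ∀ q,
      ENNReal.ofReal (C * ‖q‖) ≤ supportFun H (max ν 1) y q := fun y hy q => by
    have h0 := supportFun_add_le (H := fun _ p => ‖p‖) (x := y) (ν := 0)
      (ν' := ENNReal.ofReal C) hC0 (by simp [sublevel]) (fun p hp w hw => by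
        have : p = 0 := by simpa [sublevel] using hp
        simpa [sublevel, this] using ENNReal.ofReal_le_ofReal hw) q
    refine (le_add_self.trans h0).trans (biSup_mono fun p hp => ?_)
    exact sublevel_mono (le_max_left _ _) _ (hK y (Metric.ball_subset_closedBall hy) p
      ((ENNReal.ofReal_le_ofReal_iff hC0).1 hp))
  have h1 : ENNReal.ofReal (2 * Q) ≤ pathDist H (Metric.ball x₀ R) (max ν 1) x₀ x :=
    le_pathDist fun l γ hγ => by
      refine le_trans (ENNReal.ofReal_le_ofReal ?_) (hγ.length_ge hφ)
      have := hγ.dist_le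
      rw [← dist_eq_norm, hxR] at this
      calc 2 * Q = C * (R / 2) := by rw [hC]; field_simp
        _ ≤ C * l := by gcongr
  have h2 : u x - u x₀ ≤ 2 * Q := by
    have e1 := hQ x₀ (Metric.mem_closedBall_self hR.le)
    have e2 := hQ x (by rw [Metric.mem_closedBall, hxR]; linarith)
    rw [Real.norm_eq_abs, abs_le] at e1 e2
    linarith
  exact absurd (h1.trans_lt hlt) (not_lt.2 (ENNReal.ofReal_le_ofReal h2))

/-- The excess over the cone survives, up to `δ`, as the level tends to `μ`, because the sublevels
are left continuous in the level uniformly on the compact closure of `B'`. The uniformity requires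
curves that stay in `B'`, so the cones of the distance of `B'` are used. -/
theorem SteepAt.exists_mem_frontier_add (h : SteepAt H Ω u μ x₀) (hH : IsSupremand Ω H)
    (hΩ : IsOpen Ω) (hu : IsMetricAbsoluteMinimizer H Ω u) (hμ : μ ≠ ⊤) (hμ0 : 0 < μ)
    (hB : IsOpen B) (hB' : IsOpen B') (hBB' : closure B ⊆ B')
    (hB'c : IsCompact (closure B')) (hB'Ω : closure B' ⊆ Ω) (hx₀ : x₀ ∈ B) {δ : ℝ} (hδ : 0 < δ) :
    ∃ x ∈ frontier B, u x₀ < u x ∧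
      pathDist H Ω μ x₀ x ≤ ENNReal.ofReal (u x - u x₀) + ENNReal.ofReal δ := by
  obtain ⟨ν₀, hν₀, hν₀μ⟩ := exists_between hμ0
  obtain ⟨α, hα, hαφ⟩ := hH.exists_le_supportFun hν₀
  obtain ⟨Q, hQ⟩ := hB'c.exists_bound_of_continuousOn (hu.continuousOn.mono hB'Ω)
  have hBcl : B ⊆ closure B' := (subset_closure.trans hBB').trans subset_closure
  have hQ0 : 0 ≤ Q := (norm_nonneg _).trans (hQ x₀ (hBcl hx₀))
  have hε : 0 < δ * α / (2 * Q + 1) := by positivity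
  obtain ⟨ν₁, hν₁, hnear⟩ := hH.exists_lt_sublevel_near hμ hμ0 hB'c hB'Ω hε
  obtain ⟨x, hx, hlt⟩ := h.exists_mem_frontier hH hΩ hu (ν := max ν₀ ν₁) (max_lt hν₀μ hν₁)
    (hν₀.trans_le (le_max_left _ _)) hB hB' hBB' (subset_closure.trans hB'Ω) hx₀
  have hpos : 0 < u x - u x₀ := ENNReal.ofReal_pos.1 (pos_of_gt hlt)
  refine ⟨x, hx, sub_pos.1 hpos, ?_⟩
  obtain ⟨l, γ, hγ, hγl⟩ := exists_isPath_of_pathDist_lt hlt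
  have hux : u x - u x₀ ≤ 2 * Q := by
    have e1 := hQ x₀ (hBcl hx₀)
    have e2 := hQ x (subset_closure (hBB' (frontier_subset_closure hx)))
    rw [Real.norm_eq_abs, abs_le] at e1 e2
    linarith
  have hl : α * l ≤ 2 * Q := by
    have h1 := (hγ.length_ge (ν := max ν₀ ν₁) (α := α) fun y hy q =>
      (hαφ y (hB'Ω (subset_closure hy)) q).trans (supportFun_mono (le_max_left _ _) y q)).trans
        (hγl.le.trans (ENNReal.ofReal_le_ofReal hux))
    exact (ENNReal.ofReal_le_ofReal_iff (by positivity)).1 h1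
  have hεl : δ * α / (2 * Q + 1) * l ≤ δ := by
    rw [div_mul_eq_mul_div, div_le_iff₀ (by positivity)]
    nlinarith
  calc pathDist H Ω μ x₀ x ≤ pathDist H B' μ x₀ x := pathDist_anti (subset_closure.trans hB'Ω)
    _ ≤ finslerLength H μ γ 0 l := hγ.pathDist_le
    _ ≤ finslerLength H (max ν₀ ν₁) γ 0 l + ENNReal.ofReal (δ * α / (2 * Q + 1) * l) :=
        hγ.length_le_add fun y hy q => supportFun_le_add (fun p hp => by
          obtain ⟨p', hp', hpp⟩ := hnear y (subset_closure hy) p hp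
          exact ⟨p', sublevel_mono (le_max_right _ _) y hp', hpp⟩) q
    _ ≤ _ := add_le_add hγl.le (ENNReal.ofReal_le_ofReal hεl)

theorem SteepAt.exists_closureDist_le (h : SteepAt H Ω u μ x₀) (hH : IsSupremand Ω H)
    (hΩ : IsOpen Ω) (hbdd : Bornology.IsBounded Ω) (hΩc : Ωᶜ.Nonempty)
    (hu : IsMetricAbsoluteMinimizer H Ω u) (huc : ContinuousOn u (closure Ω)) (hμ0 : 0 < μ)
    (hx₀ : x₀ ∈ Ω) : ∃ z ∈ frontier Ω, u x₀ ≤ u z ∧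
      closureDist H Ω μ x₀ z ≤ ENNReal.ofReal (u z - u x₀) := by
  have hμ := h.ne_top hH hΩ hu hx₀
  set D : Rn n → ℝ := fun x => Metric.infDist x Ωᶜ with hD
  have hDc : Continuous D := Metric.continuous_infDist_pt _
  have hDΩ : ∀ x, 0 < D x → x ∈ Ω := fun x hx => by
    by_contra hxΩ
    exact hx.ne' (Metric.infDist_zero_of_mem hxΩ)
  have hr₀ : 0 < D x₀ :=
    (hΩ.isClosed_compl.notMem_iff_infDist_pos hΩc).1 fun h => h hx₀
  set t : ℕ → ℝ := fun k => D x₀ / ((k : ℝ) + 2) with ht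
  have ht0 : ∀ k, 0 < t k := fun k => by positivity
  have hcl : ∀ a, closure {x | a < D x} ⊆ {x | a ≤ D x} := fun a =>
    closure_minimal (fun x hx => show a ≤ D x from le_of_lt hx) (isClosed_le continuous_const hDc)
  have hclΩ : ∀ k, closure {x | t k / 2 < D x} ⊆ Ω := fun k x hx =>
    hDΩ x ((half_pos (ht0 k)).trans_le (hcl _ hx))
  have hstep : ∀ k, ∃ x ∈ frontier {x | t k < D x}, u x₀ < u x ∧
      pathDist H Ω μ x₀ x ≤ ENNReal.ofReal (u x - u x₀) + ENNReal.ofReal (t k) := fun k =>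
    h.exists_mem_frontier_add hH hΩ hu hμ hμ0 (isOpen_lt continuous_const hDc)
      (isOpen_lt continuous_const hDc)
      (fun x hx => (half_lt_self (ht0 k)).trans_le (hcl _ hx))
      ((hbdd.subset (hclΩ k)).isCompact_closure.of_isClosed_subset isClosed_closure
        subset_closure) (hclΩ k)
      (div_lt_self hr₀ (by
        have : (0 : ℝ) ≤ k := k.cast_nonneg
        linarith)) (ht0 k)
  choose x hxf hxu hxd using hstep
  have hxΩ : ∀ k, x k ∈ Ω := fun k =>
    hDΩ _ ((ht0 k).trans_le (hcl _ (frontier_subset_closure (hxf k))))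
  have hxt : ∀ k, D (x k) ≤ t k := fun k => by
    have := (isOpen_lt continuous_const hDc).frontier_eq ▸ hxf k
    exact not_lt.1 this.2
  have ht' : Tendsto t atTop (𝓝 0) := by
    refine tendsto_const_nhds.div_atTop ?_
    exact tendsto_atTop_add_const_right _ _ tendsto_natCast_atTop_atTop
  obtain ⟨z, hz, φ, hφ, hxz⟩ := hbdd.isCompact_closure.tendsto_subseq
    fun k => subset_closure (hxΩ k)
  have hDz : D z = 0 := by
    refine le_antisymm ?_ Metric.infDist_nonneg
    exact le_of_tendsto_of_tendsto ((hDc.tendsto z).comp hxz) (ht'.comp hφ.tendsto_atTop)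
      (Eventually.of_forall fun k => hxt (φ k))
  have hzΩ : z ∉ Ω := (hΩ.isClosed_compl.mem_iff_infDist_zero hΩc).2 hDz
  have hux : Tendsto (fun k => u (x (φ k))) atTop (𝓝 (u z)) :=
    (huc z hz).tendsto.comp (tendsto_nhdsWithin_iff.2
      ⟨hxz, Eventually.of_forall fun k => subset_closure (hxΩ (φ k))⟩)
  refine ⟨z, by rw [hΩ.frontier_eq]; exact ⟨hz, hzΩ⟩,
    ge_of_tendsto hux (Eventually.of_forall fun k => (hxu (φ k)).le), ?_⟩
  rw [closureDist, if_neg fun h => hzΩ h.2]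
  refine iInf_le_of_le (fun _ => x₀) <| iInf_le_of_le (fun k => x (φ k)) <|
    iInf_le_of_le (fun _ => hx₀) <| iInf_le_of_le (fun k => hxΩ (φ k)) <|
    iInf_le_of_le tendsto_const_nhds <| iInf_le_of_le hxz ?_
  have hlim : Tendsto (fun k => ENNReal.ofReal (u (x (φ k)) - u x₀) + ENNReal.ofReal (t (φ k)))
      atTop (𝓝 (ENNReal.ofReal (u z - u x₀) + ENNReal.ofReal 0)) :=
    ((ENNReal.continuous_ofReal.tendsto _).comp (hux.sub_const _)).add
      ((ENNReal.continuous_ofReal.tendsto _).comp (ht'.comp hφ.tendsto_atTop))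
  rw [ENNReal.ofReal_zero, add_zero] at hlim
  exact (liminf_le_liminf (Eventually.of_forall fun k => hxd (φ k))).trans hlim.liminf_eq.le

/-! ### The extremal extensions -/

theorem SubFinsler.le_closureDist (hu : SubFinsler H Ω μ u) (huc : ContinuousOn u (closure Ω))
    (hx : x ∈ closure Ω) (hy : y ∈ closure Ω) :
    ENNReal.ofReal (u y - u x) ≤ closureDist H Ω μ x y := by
  rw [closureDist]
  split_ifs with h
  · exact hu x y
  · refine le_iInf fun a => le_iInf fun b => le_iInf fun ha => le_iInf fun hb =>
      le_iInf fun hax => le_iInf fun hby => ?_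
    have h1 : Tendsto (fun k => u (a k)) atTop (𝓝 (u x)) := (huc x hx).tendsto.comp
      (tendsto_nhdsWithin_iff.2 ⟨hax, Eventually.of_forall fun k => subset_closure (ha k)⟩)
    have h2 : Tendsto (fun k => u (b k)) atTop (𝓝 (u y)) := (huc y hy).tendsto.comp
      (tendsto_nhdsWithin_iff.2 ⟨hby, Eventually.of_forall fun k => subset_closure (hb k)⟩)
    have h3 := (ENNReal.continuous_ofReal.tendsto _).comp (h2.sub h1)
    rw [← h3.liminf_eq]
    exact liminf_le_liminf (Eventually.of_forall fun k => hu (a k) (b k))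

theorem coe_le_coe_add {a b : ℝ} {D : ℝ≥0∞} (h : ENNReal.ofReal (a - b) ≤ D) :
    (a : EReal) ≤ (b : EReal) + (D : EReal) := by
  induction D with
  | top => simp
  | coe D =>
    rw [ENNReal.ofReal_le_iff_le_toReal ENNReal.coe_ne_top, ENNReal.coe_toReal] at h
    rw [show ((D : ℝ≥0∞) : EReal) = ((D : ℝ) : EReal) from rfl, ← EReal.coe_add,
      EReal.coe_le_coe_iff]
    linarith

theorem coe_sub_le_coe {a b : ℝ} {D : ℝ≥0∞} (h : ENNReal.ofReal (b - a) ≤ D) :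
    (b : EReal) - (D : EReal) ≤ (a : EReal) := by
  induction D with
  | top => simp
  | coe D =>
    rw [ENNReal.ofReal_le_iff_le_toReal ENNReal.coe_ne_top, ENNReal.coe_toReal] at h
    rw [show ((D : ℝ≥0∞) : EReal) = ((D : ℝ) : EReal) from rfl, ← EReal.coe_sub,
      EReal.coe_le_coe_iff]
    linarith

theorem coe_add_le_coe {a b : ℝ} {D : ℝ≥0∞} (hab : b ≤ a) (h : D ≤ ENNReal.ofReal (a - b)) :
    (b : EReal) + (D : EReal) ≤ (a : EReal) := by
  have h1 : (D : EReal) ≤ ((a - b : ℝ) : EReal) := by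
    rw [← max_eq_left (sub_nonneg.2 hab), ← EReal.coe_ennreal_ofReal]
    exact EReal.coe_ennreal_le_coe_ennreal_iff.2 h
  calc (b : EReal) + (D : EReal) ≤ (b : EReal) + ((a - b : ℝ) : EReal) := by gcongr
    _ = (a : EReal) := by rw [← EReal.coe_add, add_sub_cancel]

theorem coe_le_coe_sub {a b : ℝ} {D : ℝ≥0∞} (hab : a ≤ b) (h : D ≤ ENNReal.ofReal (b - a)) :
    (a : EReal) ≤ (b : EReal) - (D : EReal) := by
  have h1 : (D : EReal) ≤ ((b - a : ℝ) : EReal) := by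
    rw [← max_eq_left (sub_nonneg.2 hab), ← EReal.coe_ennreal_ofReal]
    exact EReal.coe_ennreal_le_coe_ennreal_iff.2 h
  calc (a : EReal) = (b : EReal) - ((b - a : ℝ) : EReal) := by
        rw [← EReal.coe_sub, sub_sub_cancel]
    _ ≤ (b : EReal) - (D : EReal) := EReal.sub_le_sub le_rfl h1

theorem SubFinsler.le_upperExt (hu : SubFinsler H Ω μ u) (huc : ContinuousOn u (closure Ω))
    (hug : ∀ y ∈ frontier Ω, u y = g y) (hx : x ∈ Ω) : (u x : EReal) ≤ upperExt H Ω g μ x :=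
  le_iInf₂ fun y hy => coe_le_coe_add <| hug y hy ▸
    hu.le_closureDist huc (frontier_subset_closure hy) (subset_closure hx)

theorem SubFinsler.lowerExt_le (hu : SubFinsler H Ω μ u) (huc : ContinuousOn u (closure Ω))
    (hug : ∀ y ∈ frontier Ω, u y = g y) (hx : x ∈ Ω) : lowerExt H Ω g μ x ≤ (u x : EReal) :=
  iSup₂_le fun y hy => coe_sub_le_coe <| hug y hy ▸
    hu.le_closureDist huc (subset_closure hx) (frontier_subset_closure hy)

/-- If `u` attains the lower extension at `x₀`, it grows at the full rate `μ` along nearly minimal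
curves from `x₀` to the boundary. As the levels are separated, this is faster than any `ν < μ`. -/
theorem SubFinsler.steepAt_of_le_lowerExt (hu : SubFinsler H Ω μ u) (hH : IsSupremand Ω H)
    (hΩ : IsOpen Ω) (huc : ContinuousOn u (closure Ω)) (hug : ∀ y ∈ frontier Ω, u y = g y)
    (hx₀ : x₀ ∈ Ω) (hle : (u x₀ : EReal) ≤ lowerExt H Ω g μ x₀) : SteepAt H Ω u μ x₀ := by
  intro ν hν r hr
  obtain ⟨α, hα, hgap⟩ := hH.exists_supportFun_add_le hν
  obtain ⟨M, hM, hMd⟩ := hH.exists_pathDist_le hν.ne_top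
  obtain ⟨R, hR, hRΩ⟩ := Metric.isOpen_iff.1 hΩ x₀ hx₀
  set ρ : ℝ := min R r / 2 with hρ
  have hρ0 : 0 < ρ := by positivity
  have hρR : ρ < R := (half_lt_self (by positivity)).trans_le (min_le_left _ _)
  have hρr : ρ < r := (half_lt_self (by positivity)).trans_le (min_le_right _ _)
  set ε : ℝ := α * ρ / 16 with hε
  have hε0 : 0 < ε := by positivity
  have hlt : ((u x₀ - ε : ℝ) : EReal) < lowerExt H Ω g μ x₀ :=
    lt_of_lt_of_le (EReal.coe_lt_coe_iff.2 (by linarith)) hle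
  simp only [lowerExt, lt_iSup_iff] at hlt
  obtain ⟨z, hz, hzlt⟩ := hlt
  have hzΩ : z ∉ Ω := by
    rw [hΩ.frontier_eq] at hz
    exact hz.2
  have hzρ : ρ < dist z x₀ := by
    refine hρR.trans_le (not_lt.1 fun h => hzΩ (hRΩ h))
  have hD : closureDist H Ω μ x₀ z < ENNReal.ofReal (g z - u x₀ + ε) := by
    by_contra! hcon
    refine absurd hzlt (not_lt.2 (coe_sub_le_coe ?_))
    rwa [show g z - (u x₀ - ε) = g z - u x₀ + ε by ring]
  rw [closureDist, if_neg fun h => hzΩ h.2] at hD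
  simp only [iInf_lt_iff] at hD
  obtain ⟨a, b, ha, hb, hax, hbz, hlim⟩ := hD
  have hub : Tendsto (fun k => u (b k)) atTop (𝓝 (u z)) :=
    (huc z (frontier_subset_closure hz)).tendsto.comp (tendsto_nhdsWithin_iff.2
      ⟨hbz, Eventually.of_forall fun k => subset_closure (hb k)⟩)
  have hη : 0 < min (ρ / 2) (α * ρ / 8 / (M + 1)) := by positivity
  have hev1 : ∀ᶠ k in atTop, dist (a k) x₀ < min (ρ / 2) (α * ρ / 8 / (M + 1)) :=
    hax.eventually (Metric.ball_mem_nhds x₀ hη)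
  have hev2 : ∀ᶠ k in atTop, ρ < dist (b k) x₀ :=
    (hbz.dist tendsto_const_nhds).eventually (lt_mem_nhds hzρ)
  have hev3 : ∀ᶠ k in atTop, g z - ε < u (b k) := by
    rw [hug z hz] at hub
    exact hub.eventually (lt_mem_nhds (by linarith))
  obtain ⟨k, hk, hk1, hk2, hk3⟩ :=
    ((frequently_lt_of_liminf_lt (by isBoundedDefault) hlim).and_eventually
      (hev1.and (hev2.and hev3))).exists
  rw [lt_min_iff] at hk1
  obtain ⟨l, γ, hγ, hγl⟩ := exists_isPath_of_pathDist_lt hk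
  -- the curve crosses the sphere of radius `ρ` around `x₀`
  obtain ⟨s, hs, hsρ⟩ : ρ ∈ (fun s => dist (γ s) x₀) '' Icc 0 l := by
    refine intermediate_value_Icc hγ.1
      ((continuous_id.dist continuous_const).comp_continuousOn hγ.continuousOn) ⟨?_, ?_⟩
    · change dist (γ 0) x₀ ≤ ρ
      rw [hγ.2.2.2.1]; linarith [hk1.1]
    · change ρ ≤ dist (γ l) x₀
      rw [hγ.2.2.2.2.1]; exact hk2.le
  simp only at hsρ
  refine ⟨γ s, by rw [Metric.mem_ball, hsρ]; exact hρr, ?_⟩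
  have hγΩ := hγ.2.2.1
  set L₁ := finslerLength H μ γ 0 s with hL₁
  set L₂ := finslerLength H μ γ s l with hL₂
  have hL : L₁ + L₂ < ENNReal.ofReal (g z - u x₀ + ε) := by
    rw [hL₁, hL₂, finslerLength_add_adjacent hs.1 hs.2]; exact hγl
  have hL₁t : L₁ ≠ ⊤ := (le_self_add.trans_lt hL).ne_top
  have hL₂t : L₂ ≠ ⊤ := (le_add_self.trans_lt hL).ne_top
  have hsum : L₁.toReal + L₂.toReal < g z - u x₀ + ε := by
    rw [← ENNReal.toReal_add hL₁t hL₂t]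
    exact (ENNReal.lt_ofReal_iff_toReal_lt (ENNReal.add_ne_top.2 ⟨hL₁t, hL₂t⟩)).1 hL
  have h2 : u (b k) - u (γ s) ≤ L₂.toReal := by
    have := (hu (γ s) (γ l)).trans (hγ.pathDist_subpath_le hs.1 hs.2 le_rfl
      fun r hr => hγΩ r ⟨hs.1.trans hr.1, hr.2⟩)
    rw [hγ.2.2.2.2.1, ENNReal.ofReal_le_iff_le_toReal hL₂t] at this
    exact this
  have hsub := hγ.subpath (V := Ω) le_rfl hs.1 hs.2 fun r hr => hγΩ r ⟨hr.1, hr.2.trans hs.2⟩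
  have h1 : pathDist H Ω ν (a k) (γ s) + ENNReal.ofReal (α * (ρ / 2)) ≤ L₁ := by
    have e1 := hsub.length_add_le hgap
    have e2 := hsub.pathDist_le (H := H) (ν := ν)
    have e3 := hsub.dist_le
    simp only [add_zero, sub_zero, hγ.2.2.2.1] at e1 e2 e3
    refine le_trans (add_le_add e2 (ENNReal.ofReal_le_ofReal ?_)) e1
    have e4 := dist_triangle (γ s) (a k) x₀
    rw [← dist_eq_norm] at e3
    gcongr
    linarith [hk1.1]
  have h3 : pathDist H Ω ν x₀ (a k) ≤ ENNReal.ofReal (α * ρ / 8) := by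
    have hseg : segment ℝ x₀ (a k) ⊆ Ω := ((convex_ball x₀ R).segment_subset
      (Metric.mem_ball_self hR) (show dist (a k) x₀ < R by linarith [hk1.1])).trans hRΩ
    refine (hMd Ω subset_rfl x₀ (a k) hseg).trans (ENNReal.ofReal_le_ofReal ?_)
    have := hk1.2
    rw [lt_div_iff₀ (by positivity)] at this
    rw [← dist_eq_norm]
    nlinarith [dist_nonneg (x := a k) (y := x₀)]
  have hfin : pathDist H Ω ν (a k) (γ s) ≠ ⊤ := ne_top_of_le_ne_top hL₁t (le_self_add.trans h1)
  have h1' : (pathDist H Ω ν (a k) (γ s)).toReal + α * (ρ / 2) ≤ L₁.toReal := by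
    have := ENNReal.toReal_mono hL₁t h1
    rwa [ENNReal.toReal_add hfin ENNReal.ofReal_ne_top,
      ENNReal.toReal_ofReal (by positivity)] at this
  calc pathDist H Ω ν x₀ (γ s)
      ≤ ENNReal.ofReal (α * ρ / 8) + pathDist H Ω ν (a k) (γ s) :=
        pathDist_triangle.trans (add_le_add h3 le_rfl)
    _ = ENNReal.ofReal (α * ρ / 8 + (pathDist H Ω ν (a k) (γ s)).toReal) := by
        rw [ENNReal.ofReal_add (by positivity) ENNReal.toReal_nonneg, ENNReal.ofReal_toReal hfin]
    _ < ENNReal.ofReal (u (γ s) - u x₀) := by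
        have hαρ : 0 < α * ρ := by positivity
        have hnn := ENNReal.toReal_nonneg (a := pathDist H Ω ν (a k) (γ s))
        have hlt : α * ρ / 8 + (pathDist H Ω ν (a k) (γ s)).toReal < u (γ s) - u x₀ := by
          linarith
        exact (ENNReal.ofReal_lt_ofReal_iff (by linarith)).2 hlt

theorem frontier_nonempty (hne : Ω.Nonempty) (hbdd : Bornology.IsBounded Ω)
    (hH : IsSupremand Ω H) (hg : MemW1InfC Ω g) (hμ : 0 < minValue H Ω g) :
    (frontier Ω).Nonempty := by
  by_contra hemp
  rw [not_nonempty_iff_eq_empty] at hemp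
  have huniv : Ω = univ := (isClopen_iff_frontier_eq_empty.2 hemp).eq_univ hne
  rcases subsingleton_or_nontrivial (Rn n) with hs | hs
  · have h0 : supFunctional H Ω g ≤ 0 := essSup_le_of_ae_le _ <| Eventually.of_forall fun x => by
      simp [Subsingleton.elim (weakGradient Ω g x) 0, hH.map_zero x (huniv ▸ mem_univ x)]
    exact absurd hμ (not_lt.2 ((iInf₂_le g ⟨hg, fun _ _ => rfl⟩).trans h0))
  · exact NormedSpace.unbounded_univ ℝ (Rn n) (huniv ▸ hbdd)

/-- For an absolute minimizer, the points of slope `μ` are the points of the uniqueness set. -/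
theorem IsAbsoluteMinimizer.pointwiseH_eq_iff (hΩ : IsOpen Ω) (hne : Ω.Nonempty)
    (hbdd : Bornology.IsBounded Ω) (hH : IsSupremand Ω H) (hg : MemW1InfC Ω g)
    (hμ : 0 < minValue H Ω g) (hu : IsAbsoluteMinimizer H Ω g u) (hx₀ : x₀ ∈ Ω) :
    pointwiseH H Ω u x₀ = minValue H Ω g ↔ x₀ ∈ uniquenessSet H Ω g := by
  have hfr := frontier_nonempty hne hbdd hH hg hμ
  have hx₀f : x₀ ∉ frontier Ω := fun h => (hΩ.frontier_eq ▸ h).2 hx₀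
  have hΩc : Ωᶜ.Nonempty := hfr.imp fun z hz => (hΩ.frontier_eq ▸ hz).2
  have huS := hu.subFinsler hH hΩ hbdd
  have huM := hu.isMetricAbsoluteMinimizer hH hbdd
  have hup := huS.le_upperExt hu.1.1.2 hu.1.2 hx₀
  have hlow := huS.lowerExt_le hu.1.1.2 hu.1.2 hx₀
  rw [pointwiseH_eq_iff_steepAt huS ((isClosed_frontier.notMem_iff_infDist_pos hfr).1 hx₀f)]
  constructor
  · intro h
    obtain ⟨z, hz, hzu, hzd⟩ := h.exists_closureDist_le hH hΩ hbdd hΩc huM hu.1.1.2 hμ hx₀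
    obtain ⟨y, hy, hyu, hyd⟩ := (h.reflect huM hH hΩ hx₀).exists_closureDist_le hH.reflect hΩ hbdd
      hΩc huM.reflect hu.1.1.2.neg hμ hx₀
    rw [closureDist_reflect] at hyd
    simp only [Pi.neg_apply, neg_le_neg_iff, neg_sub_neg] at hyu hyd
    rw [hu.1.2 z hz] at hzu hzd
    rw [hu.1.2 y hy] at hyu hyd
    have h1 : (u x₀ : EReal) ≤ lowerExt H Ω g (minValue H Ω g) x₀ :=
      (coe_le_coe_sub hzu hzd).trans (le_iSup₂ (f := fun y (_ : y ∈ frontier Ω) =>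
        (g y : EReal) - (closureDist H Ω (minValue H Ω g) x₀ y : EReal)) z hz)
    have h2 : upperExt H Ω g (minValue H Ω g) x₀ ≤ (u x₀ : EReal) :=
      (iInf₂_le y hy).trans (coe_add_le_coe hyu hyd)
    exact ⟨hx₀, (h2.antisymm hup).trans (h1.antisymm hlow)⟩
  · intro h
    exact huS.steepAt_of_le_lowerExt hH hΩ hu.1.1.2 hu.1.2 hx₀ (h.2 ▸ hup)

end Supremal

end

theorem mainTheorem9 {n : ℕ} (Ω : Set (Supremal.Rn n)) (hΩ_open : IsOpen Ω)
    (hΩ_conn : IsConnected Ω) (hΩ_bdd : Bornology.IsBounded Ω)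
    (hΩ_lip : Supremal.HasLipschitzBoundary Ω)
    (H : Supremal.Rn n → Supremal.Rn n → ℝ) (hH : Supremal.IsSupremand Ω H)
    (g : Supremal.Rn n → ℝ) (hg : Supremal.MemW1InfC Ω g)
    (hμ : 0 < Supremal.minValue H Ω g)
    (u : Supremal.Rn n → ℝ) (hu : Supremal.IsAbsoluteMinimizer H Ω g u) :
    (∀ x ∈ Ω, Supremal.pointwiseH H Ω u x = Supremal.supFunctional H Ω u →
      x ∈ Supremal.uniquenessSet H Ω g) ∧
    Supremal.attainmentSet H Ω g u = Supremal.uniquenessSet H Ω g := by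
  have hF := hu.supFunctional_eq hH hΩ_open hΩ_bdd
  have key : ∀ x ∈ Ω, Supremal.pointwiseH H Ω u x = Supremal.minValue H Ω g ↔
      x ∈ Supremal.uniquenessSet H Ω g := fun x hx =>
    hu.pointwiseH_eq_iff hΩ_open hΩ_conn.nonempty hΩ_bdd hH hg hμ hx
  refine ⟨fun x hx h => (key x hx).1 (h.trans hF), Set.ext fun x => ⟨fun h => ?_, fun h => ?_⟩⟩
  · exact (key x h.1).1 (h.2.1.trans hF)
  · exact ⟨h.1, ((key x h.1).2 h).trans hF.symm, hF⟩
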